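/- Let $\Lambda_{\mathbb Q}$ be the algebra of symmetric functions over $\mathbb Q$ in the variables $x=(x_1,x_2,\dots)$, with elementary, complete homogeneous and power sum symmetric functions $e_k,h_k,p_k$, and let $\omega$ be the algebra involution of $\Lambda_{\mathbb Q}$ with $\omega(e_k)=h_k$ for all $k\ge 1$. For $f\in\Lambda_{\mathbb Q}$ let $f(x/y)=\omega_y f(x,y)$, where $f(x,y)$ is $f$ in the union of the alphabets $x$ and $y=(y_1,y_2,\dots)$ and $\omega_y$ is $\omega$ acting on the $y$ variables only, and let $f(x/x)$ be the result of putting $y=x$ in $f(x/y)$. For $n\ge 1$ let $P_n$ be Schur's $P$-function indexed by the one-row partition $(n)$, that is, $2P_n=\sum_{k=0}^n e_kh_{n-k}$, and for a partition $\lambda$ let $V_\lambda=P_{\lambda_1}P_{\lambda_2}\cdots$ (product over the parts of $\lambda$). A parking function of length $n$ is a sequence $(a_1,\dots,a_n)$ of positive integers whose increasing rearrangement $b_1\le\cdots\le b_n$ satisfies $b_i\le i$ for all $i$; let $\mathrm{PF}_n$ be the Frobenius characteristic of the action of the symmetric group $\mathfrak S_n$ on the parking functions of length $n$ by permuting coordinates,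 and let $\mathrm{sh}_n=\mathrm{PF}_n(x/x)$. The functions $P_1,P_3,P_5,\dots$ are algebraically independent over $\mathbb Q$, and for every $n\ge 0$ $$\mathrm{sh}_n=\sum_{\substack{\lambda\vdash n\\ \text{all }\lambda_i\text{ odd}}}\frac{2^{\ell}}{\ell!}\binom{\ell}{m_1,m_3,\dots}(n+\ell-1)(n+\ell-3)\cdots(n-\ell+3)\,V_\lambda ,$$ where $\ell=\ell(\lambda)$ is the number of parts of $\lambda$, $m_i$ is the number of parts of $\lambda$ equal to $i$, and the product $(n+\ell-1)(n+\ell-3)\cdots(n-\ell+3)=\prod_{j=0}^{\ell-2}(n+\ell-1-2j)$ has $\ell-1$ factors and is read as $1$ if $\ell\le 1$. All the coefficients in this sum are nonnegative. -/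

import Mathlib

/-! Symmetric functions are formal power series over `ℚ` in the variables `x₀, x₁, x₂, …`. -/

namespace ShiftedParking

open scoped Classical in
/-- The elementary symmetric function `e_k`: the sum of all squarefree monomials of degree `k`. -/
noncomputable def elemSym (k : ℕ) : MvPowerSeries ℕ ℚ :=
  fun d => if d.degree = k ∧ ∀ i, d i ≤ 1 then 1 else 0

open scoped Classical in
/-- The complete homogeneous symmetric function `h_k`: the sum of all monomials of degree `k`. -/
noncomputable def complSym (k : ℕ) : MvPowerSeries ℕ ℚ :=
  fun d => if d.degree = k then 1 else 0

open scoped Classical in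
/-- The power sum `p_k = ∑ i, x_i ^ k` (for `k ≥ 1`). -/
noncomputable def powerSum (k : ℕ) : MvPowerSeries ℕ ℚ :=
  fun d => if ∃ i, d = Finsupp.single i k then 1 else 0

/-- Setting all but the first `N` variables to zero in `e_k` gives the elementary symmetric
polynomial in `N` variables. -/
theorem killCompl_elemSym (N k : ℕ) :
    MvPowerSeries.killCompl (R := ℚ) (Fin.valEmbedding (n := N)) (elemSym k) =
      ((MvPolynomial.esymm (Fin N) ℚ k : MvPolynomial (Fin N) ℚ) : MvPowerSeries (Fin N) ℚ) := by
  classical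
  ext d
  have key : ∀ t : Finset (Fin N), (∑ i ∈ t, Finsupp.single i 1) = d ↔
      t = d.support ∧ ∀ i, d i ≤ 1 := by
    intro t
    have hv : ∀ j, (∑ i ∈ t, Finsupp.single i (1 : ℕ)) j = if j ∈ t then 1 else 0 := by
      intro j
      simp [Finsupp.finsetSum_apply, Finsupp.single_apply]
    constructor
    · rintro rfl
      refine ⟨?_, ?_⟩
      · ext j
        rw [Finsupp.mem_support_iff, hv]
        simp
      · intro j
        rw [hv]
        split_ifs <;> simp
    · rintro ⟨rfl, h⟩
      ext j
      rw [hv]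
      have := h j
      by_cases hj : d j = 0
      · simp [hj]
      · simp [hj]
        omega
  have hdeg : (Finsupp.embDomain Fin.valEmbedding d).degree = d.degree := by
    rw [Finsupp.degree_apply, Finsupp.degree_apply, Finsupp.support_embDomain, Finset.sum_map]
    exact Finset.sum_congr rfl fun i _ => Finsupp.embDomain_apply_self _ _ _
  have hle : (∀ i, (Finsupp.embDomain (Fin.valEmbedding (n := N)) d) i ≤ 1) ↔ ∀ i, d i ≤ 1 := by
    constructor
    · intro h i
      have := h (Fin.valEmbedding i)
      rwa [Finsupp.embDomain_apply_self] at this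
    · intro h i
      by_cases hi : i ∈ Set.range (Fin.valEmbedding (n := N))
      · obtain ⟨j, rfl⟩ := hi
        rw [Finsupp.embDomain_apply_self]
        exact h j
      · rw [Finsupp.embDomain_of_notMem_range _ _ _ hi]
        exact Nat.zero_le _
  rw [MvPowerSeries.coeff_killCompl, MvPolynomial.coeff_coe, MvPolynomial.esymm_eq_sum_monomial,
    MvPolynomial.coeff_sum]
  simp only [MvPolynomial.coeff_monomial, key]
  change (if _ ∧ _ then (1 : ℚ) else 0) = _
  rw [hdeg, hle]
  by_cases h1 : ∀ i, d i ≤ 1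
  · have hcard : d.degree = d.support.card := by
      rw [Finsupp.degree_apply, Finset.card_eq_sum_ones]
      refine Finset.sum_congr rfl fun i hi => ?_
      have := h1 i
      have := Finsupp.mem_support_iff.1 hi
      omega
    simp only [h1, implies_true, and_true, Finset.sum_ite_eq', Finset.mem_powersetCard_univ,
      hcard]
  · simp [h1]

/-- The functions `e_1, e_2, e_3, …` are algebraically independent. -/
theorem elemSym_algebraicIndependent :
    AlgebraicIndependent ℚ (fun i : ℕ => elemSym (i + 1)) := by
  rw [algebraicIndependent_iff]
  intro p hp
  obtain ⟨N, hN⟩ : ∃ N, ∀ i ∈ p.vars, i < N :=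
    ⟨p.vars.sup id + 1, fun i hi => Nat.lt_succ_of_le (Finset.le_sup (f := id) hi)⟩
  obtain ⟨q, rfl⟩ := MvPolynomial.exists_rename_eq_of_vars_subset_range p
    (Fin.val : Fin N → ℕ) Fin.val_injective (fun i hi => ⟨⟨i, hN i hi⟩, rfl⟩)
  have h := congrArg (MvPowerSeries.killCompl (R := ℚ) (Fin.valEmbedding (n := N))) hp
  rw [MvPolynomial.aeval_rename, map_zero, ← AlgHom.comp_apply, MvPolynomial.comp_aeval] at h
  have h2 : MvPolynomial.aeval (fun i : Fin N => MvPolynomial.esymm (Fin N) ℚ (i + 1)) q = 0 := by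
    apply MvPolynomial.coe_injective (Fin N) ℚ
    have h3 := MvPolynomial.comp_aeval (R := ℚ)
      (fun i : Fin N => MvPolynomial.esymm (Fin N) ℚ (i + 1))
      (MvPolynomial.coeToMvPowerSeries.algHom (σ := Fin N) (R := ℚ) ℚ)
    have h4 := DFunLike.congr_fun h3 q
    simp only [AlgHom.comp_apply, MvPolynomial.coeToMvPowerSeries.algHom_apply] at h4
    simp only [Function.comp_def, killCompl_elemSym] at h
    exact (h4.trans h).trans MvPolynomial.coe_zero.symm
  have hinj := MvPolynomial.esymmAlgHom_fin_injective (R := ℚ) (le_refl N)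
  have hq : q = 0 := by
    apply hinj
    apply Subtype.ext
    rw [MvPolynomial.esymmAlgHom_apply, h2, map_zero]
    rfl
  rw [hq, map_zero]

/-- The algebra `Λ_ℚ = ℚ[e_1, e_2, e_3, …]` of symmetric functions over `ℚ`. -/
noncomputable abbrev symFun : Subalgebra ℚ (MvPowerSeries ℕ ℚ) :=
  Algebra.adjoin ℚ (Set.range fun i : ℕ => elemSym (i + 1))

/-- The involution `ω`: the algebra homomorphism on `Λ_ℚ` with `ω e_k = h_k` for all `k ≥ 1`. -/
noncomputable def omega : symFun →ₐ[ℚ] MvPowerSeries ℕ ℚ :=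
  (MvPolynomial.aeval fun i : ℕ => complSym (i + 1)).comp
    elemSym_algebraicIndependent.aevalEquiv.symm.toAlgHom

theorem omega_elemSym (i : ℕ) :
    omega ⟨elemSym (i + 1), Algebra.subset_adjoin ⟨i, rfl⟩⟩ = complSym (i + 1) := by
  have h : (⟨elemSym (i + 1), Algebra.subset_adjoin ⟨i, rfl⟩⟩ :
      Algebra.adjoin ℚ (Set.range fun i : ℕ => elemSym (i + 1))) =
      elemSym_algebraicIndependent.aevalEquiv (MvPolynomial.X i) := by
    apply Subtype.ext
    simp
  change MvPolynomial.aeval _ (elemSym_algebraicIndependent.aevalEquiv.symm _) = _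
  rw [h, AlgEquiv.symm_apply_apply, MvPolynomial.aeval_X]

/-- `f(x, y)`: the symmetric function `f` in the union of the alphabets `x` (the left summand)
and `y` (the right summand). For symmetric `f` the bijection `ℕ ⊕ ℕ ≃ ℕ` is immaterial. -/
noncomputable def twoAlphabets (f : MvPowerSeries ℕ ℚ) : MvPowerSeries (ℕ ⊕ ℕ) ℚ :=
  MvPowerSeries.rename Equiv.natSumNatEquivNat.symm f

/-- The coefficient of the monomial `x ^ a` in `F(x, y)`, a power series in `y`. -/
noncomputable def coeffX (a : ℕ →₀ ℕ) (F : MvPowerSeries (ℕ ⊕ ℕ) ℚ) : MvPowerSeries ℕ ℚ :=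
  fun b => MvPowerSeries.coeff (Finsupp.sumElim a b) F

open scoped Classical in
/-- `ω_y F`: the involution `ω` acting on the `y` variables only, that is, on the coefficient
of each monomial in the `x` variables (coefficients outside `Λ_ℚ` are sent to `0`). -/
noncomputable def omegaY (F : MvPowerSeries (ℕ ⊕ ℕ) ℚ) : MvPowerSeries (ℕ ⊕ ℕ) ℚ :=
  fun d =>
    let a : ℕ →₀ ℕ := (Finsupp.sumFinsuppEquivProdFinsupp d).1
    let b : ℕ →₀ ℕ := (Finsupp.sumFinsuppEquivProdFinsupp d).2
    if h : coeffX a F ∈ symFun then MvPowerSeries.coeff b (omega ⟨coeffX a F, h⟩) else 0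

/-- The superfication `f(x/y) = ω_y f(x, y)`. -/
noncomputable def superfication (f : MvPowerSeries ℕ ℚ) : MvPowerSeries (ℕ ⊕ ℕ) ℚ :=
  omegaY (twoAlphabets f)

instance tendstoCofinite_fold :
    Filter.TendstoCofinite (Sum.elim id id : ℕ ⊕ ℕ → ℕ) := by
  rw [Filter.tendstoCofinite_iff_finite_preimage_singleton]
  intro b
  refine Set.Finite.subset (Set.toFinite {Sum.inl b, Sum.inr b}) ?_
  rintro (x | x) hx <;> simp_all

/-- The shiftification `f(x/x)`: put `y = x` in `f(x/y)`. -/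
noncomputable def shiftification (f : MvPowerSeries ℕ ℚ) : MvPowerSeries ℕ ℚ :=
  MvPowerSeries.rename (Sum.elim id id : ℕ ⊕ ℕ → ℕ) (superfication f)

/-- Parking functions of length `n`: sequences of positive integers whose increasing
rearrangement `b_1 ≤ ⋯ ≤ b_n` satisfies `b_i ≤ i`. -/
def IsParking {n : ℕ} (a : Fin n → ℕ) : Prop :=
  (∀ i, 0 < a i) ∧ ∀ i : Fin n, (a ∘ Tuple.sort a) i ≤ (i : ℕ) + 1

/-- The set of parking functions of length `n`. -/
def Parking (n : ℕ) : Type := {a : Fin n → ℕ // IsParking a}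

theorem IsParking.comp_perm {n : ℕ} {a : Fin n → ℕ} (h : IsParking a)
    (w : Equiv.Perm (Fin n)) : IsParking (a ∘ w) := by
  refine ⟨fun i => h.1 (w i), fun i => ?_⟩
  rw [Tuple.comp_perm_comp_sort_eq_comp_sort]
  exact h.2 i

/-- The symmetric group acts on parking functions by permuting coordinates. -/
instance parkingAction (n : ℕ) : MulAction (Equiv.Perm (Fin n)) (Parking n) where
  smul w a := ⟨a.1 ∘ (w⁻¹ : Equiv.Perm (Fin n)), a.2.comp_perm w⁻¹⟩
  one_smul _ := rfl
  mul_smul w v a := Subtype.ext (by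
    change a.1 ∘ ((w * v)⁻¹ : Equiv.Perm (Fin n)) =
      (a.1 ∘ (v⁻¹ : Equiv.Perm (Fin n))) ∘ (w⁻¹ : Equiv.Perm (Fin n))
    rw [mul_inv_rev]
    rfl)

/-- The Frobenius characteristic of a class function `χ` on the symmetric group:
`(1 / n!) ∑ w, χ(w) p_{ρ(w)}`, where `ρ(w)` is the cycle type of `w`, fixed points included. -/
noncomputable def frobeniusChar {n : ℕ} (χ : Equiv.Perm (Fin n) → ℚ) : MvPowerSeries ℕ ℚ :=
  ((n.factorial : ℚ)⁻¹) • ∑ w : Equiv.Perm (Fin n), χ w • (w.partition.parts.map powerSum).prod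

/-- The parking function symmetric function `PF_n`: the Frobenius characteristic of the
permutation character of the symmetric group on parking functions of length `n`. -/
noncomputable def parkingSym (n : ℕ) : MvPowerSeries ℕ ℚ :=
  frobeniusChar fun w : Equiv.Perm (Fin n) => (Nat.card (MulAction.fixedBy (Parking n) w) : ℚ)

/-- The shifted parking function symmetric function `sh_n = PF_n(x/x)`. -/
noncomputable def shiftedParkingSym (n : ℕ) : MvPowerSeries ℕ ℚ :=
  shiftification (parkingSym n)

/-- Schur's `P`-function `P_n` indexed by the one-row partition `(n)`, for `n ≥ 1`:
`2 P_n = ∑_{k=0}^n e_k h_{n-k}`. -/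
noncomputable def schurP (n : ℕ) : MvPowerSeries ℕ ℚ :=
  (1 / 2 : ℚ) • ∑ k ∈ Finset.range (n + 1), elemSym k * complSym (n - k)

/-- `V_λ = P_{λ_1} P_{λ_2} ⋯`. -/
noncomputable def prodP {n : ℕ} (lam : n.Partition) : MvPowerSeries ℕ ℚ :=
  (lam.parts.map schurP).prod

/-- The number `(2^ℓ / ℓ!) * binom(ℓ; m_1, m_3, …) * (n+ℓ-1)(n+ℓ-3)⋯(n-ℓ+3)`, where `ℓ` is the
length of `λ` and `m_i` the number of its parts equal to `i`; the last product has `ℓ - 1`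
factors (none if `ℓ ≤ 1`). -/
def shiftedCoeff {n : ℕ} (lam : n.Partition) : ℚ :=
  (2 : ℚ) ^ lam.parts.card / (lam.parts.card.factorial : ℚ)
    * (Nat.multinomial lam.parts.toFinset (fun i => lam.parts.count i) : ℚ)
    * ∏ j ∈ Finset.range (lam.parts.card - 1),
        ((n : ℚ) + (lam.parts.card : ℚ) - 1 - 2 * (j : ℚ))

end ShiftedParking

/-! Rotating values modulo `n + 1` (Pollak's circle argument, `existsUnique_parking_shift`) shows
that a permutation `w` with `c` cycles fixes `(n + 1)^(c - 1)` parking functions when `n ≥ 1`;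
`card_fixedBy_parking` has the form without subtraction. Since `ω` sends `p_k` to `(-1)^(k-1) p_k`,
shiftification is multiplicative on products of power sums and replaces `p_k` by `(1 - (-1)^k) p_k`.
Hence `sh_n` is `1/(n+1)` times a cycle index, which is the coefficient of `t^n` in `Q^(n+1)`, where
`Q = E(t) H(t) = 1 + ∑ 2 P_k t^k` has logarithmic derivative `∑ (1 - (-1)^k) p_k t^(k-1)`.

That logarithmic derivative is even in `t`, so the odd part `A` and the even part `B` of `Q` behave
like `sinh` and `cosh`: `B² = 1 + A²` and `Q = A + √(1 + A²)`. The classical expansion of `(u + √(1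
+ u²))^α` at `α = n + 1`, `u = A` writes `Q^(n+1)` in powers of `A = ∑ 2 P_k t^k` (`k` odd), and the
multinomial theorem gives the formula. No root or real power is formed: `cycleIndex_eq_coeff`
compares two solutions of one first-order linear differential equation.

For algebraic independence, `exists_algHom_schurP` specializes the free generators `e_k` so that the
odd `P_k` become independent variables. Put `E = 1 + a` with `a` odd; then `E(t) H(-t) = 1` forces
`H = 1/(1 - a)`, and `Q(t) - Q(-t) = 4a/(1 - a²)`. Any prescribed odd series `x` equals `a/(1 - a²)`
for an odd `a` given by the Catalan series. -/

namespace ShiftedParking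

/-! ### Parking functions fixed by a permutation -/

section
open Equiv Equiv.Perm

/-- `cycleType` omits fixed points while `partition` restores them as ones, so an orbit is matched
either with a nontrivial cycle factor or with a fixed point. -/
theorem card_quotient_sameCycle {α : Type*} [Fintype α] [DecidableEq α] (w : Perm α) :
    Nat.card (Quotient (SameCycle.setoid w)) = w.partition.parts.card := by
  classical
  let φ : α → w.cycleFactorsFinset ⊕ Function.fixedPoints w := fun x =>
    if h : w x = x then Sum.inr ⟨x, h⟩
    else Sum.inl ⟨w.cycleOf x, cycleOf_mem_cycleFactorsFinset_iff.2 (mem_support.2 h)⟩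
  have hφ : ∀ x y, φ x = φ y ↔ w.SameCycle x y := by
    intro x y
    by_cases hx : w x = x <;> by_cases hy : w y = y
    · simp only [φ, hx, hy, dif_pos, Sum.inr.injEq]
      refine ⟨fun h => ?_, fun h => Subtype.ext (h.eq_of_left hx)⟩
      obtain rfl : x = y := congrArg Subtype.val h
      exact SameCycle.refl _ _
    · simp only [φ, hx, hy, dif_pos, dif_neg, not_false_eq_true, reduceCtorEq, false_iff]
      exact fun h => hy (h.apply_eq_self_iff.1 hx)
    · simp only [φ, hx, hy, dif_pos, dif_neg, not_false_eq_true, reduceCtorEq, false_iff]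
      exact fun h => hx (h.apply_eq_self_iff.2 hy)
    · simp only [φ, hx, hy, dif_neg, not_false_eq_true, Sum.inl.injEq, Subtype.mk.injEq]
      rw [sameCycle_iff_cycleOf_eq_of_mem_support (mem_support.2 hx) (mem_support.2 hy)]
  let ψ : Quotient (SameCycle.setoid w) → w.cycleFactorsFinset ⊕ Function.fixedPoints w :=
    Quotient.lift φ fun x y h => (hφ x y).2 h
  have hψ : Function.Bijective ψ := by
    constructor
    · rintro ⟨x⟩ ⟨y⟩ h
      exact Quotient.sound ((hφ x y).1 h)
    · rintro (⟨c, hc⟩ | ⟨x, hx⟩)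
      · obtain ⟨x, hx⟩ := (mem_cycleFactorsFinset_iff.1 hc).1.nonempty_support
        have hcx := cycle_is_cycleOf hx hc
        have hwx : ¬ w x = x :=
          mem_support.1 (mem_cycleFactorsFinset_support_le hc hx)
        refine ⟨Quotient.mk _ x, ?_⟩
        change φ x = _
        simp only [φ, hwx, dif_neg, not_false_eq_true, hcx]
      · refine ⟨Quotient.mk _ x, ?_⟩
        change φ x = _
        have : w x = x := hx
        simp only [φ, this, dif_pos]
  rw [Nat.card_congr (Equiv.ofBijective ψ hψ), Nat.card_sum, parts_partition, Multiset.card_add,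
    Multiset.card_replicate, Nat.card_eq_fintype_card, Nat.card_eq_fintype_card,
    card_fixedPoints, sum_cycleType]
  simp [cycleType_def]

/-- The functions constant on the cycles of `w`. -/
theorem card_invariant_functions {α β : Type*} [Fintype α] [DecidableEq α] [Finite β]
    (w : Perm α) :
    Nat.card {f : α → β // f ∘ w = f} = Nat.card β ^ w.partition.parts.card := by
  rw [← card_quotient_sameCycle, ← Nat.card_fun]
  have hz : ∀ f : α → β, f ∘ w = f → ∀ x y, w.SameCycle x y → f x = f y := by
    intro f hf x y h
    obtain ⟨i, rfl⟩ := h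
    have key : ∀ (k : ℕ) x, f ((w ^ k) x) = f x := by
      intro k
      induction k with
      | zero => simp
      | succ k ih => intro x; rw [pow_succ', Perm.mul_apply, ← ih x]; exact congrFun hf _
    obtain ⟨k, rfl | rfl⟩ := i.eq_nat_or_neg
    · rw [zpow_natCast, key]
    · rw [zpow_neg, zpow_natCast]
      conv_lhs => rw [show x = (w ^ k) ((w ^ k)⁻¹ x) by simp, key]
  refine Nat.card_congr
    { toFun := fun f => Quotient.lift f.1 fun x y h => hz f.1 f.2 x y h
      invFun := fun g => ⟨fun x => g (Quotient.mk _ x), funext fun x =>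
        congrArg g (Quotient.sound (s := SameCycle.setoid w) ⟨-1, by simp⟩)⟩
      left_inv := fun f => rfl
      right_inv := fun g => funext fun q => Quotient.inductionOn q fun _ => rfl }

/-- The counting form is what a partial-sum argument can use. Positivity needs no separate clause:
the case `k = n` forces all `n` entries into `[1, n]`. -/
theorem isParking_iff {n : ℕ} (a : Fin n → ℕ) :
    IsParking a ↔ ∀ k ≤ n, k ≤ (Finset.univ.filter fun i => 1 ≤ a i ∧ a i ≤ k).card := by
  have hsort : ∀ k, (Finset.univ.filter fun i => a i ≤ k).card =
      (Finset.univ.filter fun i => (a ∘ Tuple.sort a) i ≤ k).card := by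
    intro k
    symm
    refine Finset.card_equiv (Tuple.sort a) fun i => by simp
  have hmono : Monotone (a ∘ Tuple.sort a) := Tuple.monotone_sort a
  constructor
  · rintro ⟨hpos, h⟩ k hk
    have h1 : ∀ i, 1 ≤ a i := hpos
    simp only [h1, true_and]
    rw [hsort]
    calc k = (Finset.univ.filter fun i : Fin n => (i : ℕ) < k).card := by
          rw [Fin.card_filter_val_lt, min_eq_right hk]
      _ ≤ _ := by
          refine Finset.card_le_card fun i hi => ?_
          simp only [Finset.mem_filter, Finset.mem_univ, true_and] at hi ⊢
          exact (h i).trans hi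
  · intro h
    have hpos : ∀ i, 0 < a i := by
      intro i
      have h1 := h n le_rfl
      have h2 : (Finset.univ.filter fun i => 1 ≤ a i ∧ a i ≤ n) = Finset.univ := by
        apply Finset.eq_univ_of_card
        refine le_antisymm (Finset.card_le_univ _) (by simpa using h1)
      have := (Finset.ext_iff.1 h2 i).2 (Finset.mem_univ i)
      simp only [Finset.mem_filter] at this
      exact this.2.1
    refine ⟨hpos, fun i => ?_⟩
    by_contra hi
    push Not at hi
    have h1 := h (i + 1) i.2
    have h2 : ∀ j, 1 ≤ a j := hpos
    simp only [h2, true_and] at h1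
    rw [hsort] at h1
    have h3 : (Finset.univ.filter fun j => (a ∘ Tuple.sort a) j ≤ (i : ℕ) + 1) ⊆
        Finset.univ.filter fun j : Fin n => (j : ℕ) < i := by
      intro j hj
      simp only [Finset.mem_filter, Finset.mem_univ, true_and] at hj ⊢
      by_contra hji
      push Not at hji
      have := hmono (show i ≤ j from hji)
      omega
    have h4 := Finset.card_le_card h3
    rw [Fin.card_filter_val_lt, min_eq_right i.2.le] at h4
    omega

/-- The cycle lemma: an integer sequence that drops by one over each period of length `n + 1` has
exactly one starting point per period from which it does not fall for `n` steps. -/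
theorem existsUnique_start {n : ℕ} {S : ℕ → ℤ} (hS : ∀ v, S (v + (n + 1)) = S v - 1) :
    ∃! s, s ≤ n ∧ ∀ k ≤ n, S s ≤ S (s + k) := by
  classical
  have hex : ∃ s, s ≤ n ∧ ∀ v ≤ n, S s ≤ S v := by
    obtain ⟨s, hs, h⟩ := Finset.exists_min_image (Finset.range (n + 1)) S ⟨0, by simp⟩
    exact ⟨s, by simpa [Nat.lt_succ_iff] using hs, fun v hv => h v (by simpa [Nat.lt_succ_iff])⟩
  obtain ⟨h1, h2⟩ := Nat.find_spec hex
  have hmin : ∀ v < Nat.find hex, S (Nat.find hex) < S v := by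
    intro v hv
    by_contra hcon
    push Not at hcon
    exact Nat.find_min hex hv ⟨by omega, fun u hu => hcon.trans (h2 u hu)⟩
  have hs' : ∀ k ≤ n, S (Nat.find hex) ≤ S (Nat.find hex + k) := by
    intro k hk
    rcases le_or_gt (Nat.find hex + k) n with h | h
    · exact h2 _ h
    -- After wrapping around, the value is `S v - 1` with `v` before the first minimizer, where `S`
    -- is strictly larger; this is why the first minimizer is taken.
    · obtain ⟨v, hv⟩ := Nat.exists_eq_add_of_le (show n + 1 ≤ Nat.find hex + k from h)
      rw [hv, add_comm (n + 1), hS]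
      have := hmin v (by omega)
      omega
  have huniq : ∀ s t, s < t → t ≤ n → (∀ k ≤ n, S s ≤ S (s + k)) →
      (∀ k ≤ n, S t ≤ S (t + k)) → False := by
    intro s t hst ht hs' ht'
    have a1 := hs' (t - s) (by omega)
    have a2 := ht' (s + (n + 1) - t) (by omega)
    rw [show s + (t - s) = t by omega] at a1
    rw [show t + (s + (n + 1) - t) = s + (n + 1) by omega, hS] at a2
    omega
  refine ⟨Nat.find hex, ⟨h1, hs'⟩, ?_⟩
  rintro t ⟨ht, ht'⟩
  rcases lt_trichotomy t (Nat.find hex) with h | h | h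
  · exact (huniq _ _ h h1 ht' hs').elim
  · exact h
  · exact (huniq _ _ h ht hs' ht').elim

/-- The partial sums of (number of preimages of `u`) minus 1 drop by one per period, as `n` cars
meet `n + 1` spots, so the cycle lemma selects one rotation. -/
theorem existsUnique_parking_shift {n : ℕ} (f : Fin n → ZMod (n + 1)) :
    ∃! c : ZMod (n + 1), IsParking fun i => (f i - c).val := by
  classical
  let m : ℕ → ℕ := fun u => (Finset.univ.filter fun i => f i = (u : ZMod (n + 1))).card
  let S : ℕ → ℤ := fun v => ∑ u ∈ Finset.range v, ((m u : ℤ) - 1)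
  have hblock : ∀ v k, k ≤ n + 1 → (∑ u ∈ Finset.range k, m (v + u)) =
      (Finset.univ.filter fun i => (f i - v).val < k).card := by
    intro v k hk
    rw [Finset.card_eq_sum_card_fiberwise (f := fun i => (f i - v).val) (t := Finset.range k)
      (fun i hi => by simpa using hi)]
    refine Finset.sum_congr rfl fun u hu => ?_
    rw [Finset.mem_range] at hu
    refine congrArg Finset.card (Finset.ext fun i => ?_)
    simp only [Finset.mem_filter, Finset.mem_univ, true_and]
    have hval : ((u : ZMod (n + 1))).val = u := ZMod.val_cast_of_lt (by omega)
    constructor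
    · intro h
      have h1 : f i - v = u := by rw [h]; push_cast; ring
      rw [h1, hval]
      exact ⟨hu, rfl⟩
    · rintro ⟨-, h⟩
      have h1 : f i - v = u := by
        apply ZMod.val_injective
        rw [h, hval]
      rw [sub_eq_iff_eq_add.1 h1]; push_cast; ring
  have hdiff : ∀ v k, k ≤ n + 1 → S (v + k) - S v =
      ((Finset.univ.filter fun i => (f i - v).val < k).card : ℤ) - k := by
    intro v k hk
    simp only [S]
    rw [Finset.sum_range_add, add_sub_cancel_left, ← hblock v k hk, Finset.sum_sub_distrib]
    simp
  have hS : ∀ v, S (v + (n + 1)) = S v - 1 := by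
    intro v
    have h := hdiff v (n + 1) le_rfl
    rw [Finset.filter_true_of_mem fun i _ => ZMod.val_lt _] at h
    simp only [Finset.card_univ, Fintype.card_fin] at h
    push_cast at h
    linarith
  -- The shift is `s - 1` because parking values start at 1: residue `s` becomes value 1, and `s -
  -- 1` becomes the forbidden value 0.
  have hpark : ∀ s : ℕ, IsParking (fun i => (f i - ((s : ZMod (n + 1)) - 1)).val) ↔
      ∀ k ≤ n, S s ≤ S (s + k) := by
    intro s
    rw [isParking_iff]
    refine forall₂_congr fun k hk => ?_
    have h := hdiff s k (by omega)
    have h2 : (Finset.univ.filter fun i => 1 ≤ (f i - ((s : ZMod (n + 1)) - 1)).val ∧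
        (f i - ((s : ZMod (n + 1)) - 1)).val ≤ k) =
        Finset.univ.filter fun i => (f i - s).val < k := by
      ext i
      simp only [Finset.mem_filter, Finset.mem_univ, true_and]
      set z := f i - (s : ZMod (n + 1)) with hz
      rw [show f i - ((s : ZMod (n + 1)) - 1) = z + 1 by rw [hz]; ring]
      rcases n with _ | n
      · exact i.elim0
      · by_cases hzn : z.val = n + 1
        · have : z + 1 = 0 := by
            rw [← ZMod.natCast_zmod_val z, hzn]
            exact_mod_cast ZMod.natCast_self (n + 1 + 1)
          rw [this, hzn]
          simp
          omega
        · have hlt := ZMod.val_lt z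
          have : Fact (1 < n + 1 + 1) := ⟨by omega⟩
          have : (z + 1).val = z.val + 1 := by
            rw [ZMod.val_add_of_lt, ZMod.val_one]
            rw [ZMod.val_one]; omega
          rw [this]
          omega
    rw [h2]
    omega
  obtain ⟨s, ⟨hs, hs'⟩, huniq⟩ := existsUnique_start hS
  refine ⟨(s : ZMod (n + 1)) - 1, (hpark s).2 hs', fun c hc => ?_⟩
  have hcc : c = (((c + 1).val : ℕ) : ZMod (n + 1)) - 1 := by
    rw [ZMod.natCast_zmod_val]; ring
  have hlt := ZMod.val_lt (c + 1)
  rw [hcc] at hc ⊢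
  rw [huniq _ ⟨by omega, (hpark _).1 hc⟩]

theorem IsParking.le {n : ℕ} {a : Fin n → ℕ} (h : IsParking a) (i : Fin n) : a i ≤ n := by
  have h1 := h.2 ((Tuple.sort a).symm i)
  have h2 := ((Tuple.sort a).symm i).2
  simp only [Function.comp_apply, Equiv.apply_symm_apply] at h1
  omega

/-- Adding a constant residue `c` commutes with permuting coordinates, so `(a, c) ↦ a + c` is a
bijection from fixed parking functions times `ZMod (n + 1)` to the `w`-invariant functions. -/
theorem card_fixedBy_parking (n : ℕ) (w : Perm (Fin n)) :
    Nat.card (MulAction.fixedBy (Parking n) w) * (n + 1) =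
      (n + 1) ^ w.partition.parts.card := by
  have h1 := card_invariant_functions (β := ZMod (n + 1)) w
  rw [Nat.card_zmod] at h1
  rw [← h1]
  conv_lhs => rw [← Nat.card_zmod (n + 1), ← Nat.card_prod]
  have hval : ∀ (a : Fin n → ℕ), IsParking a → ∀ i, ((a i : ZMod (n + 1))).val = a i :=
    fun a ha i => ZMod.val_cast_of_lt (Nat.lt_succ_of_le (ha.le i))
  have hfix : ∀ a : Parking n, a ∈ MulAction.fixedBy (Parking n) w ↔ a.1 ∘ w = a.1 := by
    intro a
    rw [MulAction.mem_fixedBy]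
    constructor
    · intro h
      have : a.1 ∘ (w⁻¹ : Perm (Fin n)) = a.1 := congrArg Subtype.val h
      conv_lhs => rw [← this]
      ext i
      simp
    · intro h
      apply Subtype.ext
      change a.1 ∘ (w⁻¹ : Perm (Fin n)) = a.1
      conv_lhs => rw [← h]
      ext i
      simp
  refine Nat.card_congr (Equiv.ofBijective
    (fun p => ⟨fun i => (p.1.1.1 i : ZMod (n + 1)) + p.2, funext fun i => by
      have := congrFun ((hfix p.1.1).1 p.1.2) i
      simp only [Function.comp_apply] at this ⊢
      rw [this]⟩) ⟨?_, ?_⟩)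
  · rintro ⟨⟨⟨a, ha⟩, haw⟩, c⟩ ⟨⟨⟨b, hb⟩, hbw⟩, d⟩ h
    have h' : ∀ i, (a i : ZMod (n + 1)) + c = b i + d := fun i =>
      congrFun (congrArg Subtype.val h) i
    obtain ⟨u, -, hu⟩ := existsUnique_parking_shift fun i => (a i : ZMod (n + 1)) + c
    have hc : c = u := hu c (by simpa [hval a ha] using ha)
    have hd : d = u := hu d (by simpa [h', hval b hb] using hb)
    subst hc
    subst hd
    have hab : a = b := funext fun i => by
      rw [← hval a ha, ← hval b hb, add_right_cancel (h' i)]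
    subst hab
    rfl
  · rintro ⟨f, hf⟩
    obtain ⟨c, hc, -⟩ := existsUnique_parking_shift f
    refine ⟨⟨⟨⟨_, hc⟩, (hfix _).2 ?_⟩, c⟩, ?_⟩
    · ext i
      have := congrFun hf i
      simp only [Function.comp_apply] at this ⊢
      rw [this]
    · apply Subtype.ext
      ext i
      simp

end

/-! ### Cycle index of the symmetric group -/

section
open Equiv Equiv.Perm

/-- The order of the centralizer of a permutation with cycle lengths `m`. -/
def centralizerOrder (m : Multiset ℕ) : ℕ :=
  m.prod * ∏ i ∈ m.toFinset, (m.count i).factorial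

theorem prod_count_factorial {m : Multiset ℕ} {s : Finset ℕ} (h : m.toFinset ⊆ s) :
    ∏ i ∈ m.toFinset, (m.count i).factorial = ∏ i ∈ s, (m.count i).factorial := by
  refine Finset.prod_subset h fun i _ hi => ?_
  rw [Multiset.mem_toFinset] at hi
  rw [Multiset.count_eq_zero_of_notMem hi, Nat.factorial_zero]

theorem centralizerOrder_cons (a : ℕ) (m : Multiset ℕ) :
    centralizerOrder (a ::ₘ m) = a * (a ::ₘ m).count a * centralizerOrder m := by
  have h : m.toFinset ⊆ (a ::ₘ m).toFinset := by
    rw [Multiset.toFinset_cons]; exact Finset.subset_insert _ _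
  have ha : a ∈ (a ::ₘ m).toFinset := by simp
  unfold centralizerOrder
  rw [prod_count_factorial h, Multiset.prod_cons, ← Finset.mul_prod_erase _ _ ha,
    ← Finset.mul_prod_erase _ (fun i => (m.count i).factorial) ha,
    Finset.prod_congr rfl fun i hi => by
      rw [Multiset.count_cons_of_ne (Finset.ne_of_mem_erase hi)]]
  rw [Multiset.count_cons_self, Nat.factorial_succ]
  ring

theorem centralizerOrder_ne_zero {m : Multiset ℕ} (h : ∀ i ∈ m, 0 < i) :
    centralizerOrder m ≠ 0 := by
  refine mul_ne_zero (Multiset.prod_ne_zero fun h0 => (h 0 h0).false)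
    (Finset.prod_ne_zero_iff.2 fun i _ => Nat.factorial_ne_zero _)

/-- The count by `cycleType` sees only the parts `c` of size at least 2; the remaining `n - c.sum`
fixed points supply the factorial of the multiplicity of 1. -/
theorem card_partition_eq_mul {n : ℕ} {m : Multiset ℕ} (hpos : ∀ i ∈ m, 0 < i)
    (hsum : m.sum = n) :
    (Finset.univ.filter fun w : Perm (Fin n) => w.partition.parts = m).card *
      centralizerOrder m = n.factorial := by
  classical
  set c := m.filter (2 ≤ ·) with hc
  have hm : m = c + Multiset.replicate (m.count 1) 1 := by
    conv_lhs => rw [← Multiset.filter_add_not (2 ≤ ·) m]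
    rw [← Multiset.filter_eq', hc]
    congr 1
    refine Multiset.filter_congr fun i hi => ?_
    have := hpos i hi
    omega
  have hsum' : c.sum + m.count 1 = n := by
    have := congrArg Multiset.sum hm
    rw [Multiset.sum_add, Multiset.sum_replicate, hsum] at this
    simpa using this.symm
  have hiff : ∀ w : Perm (Fin n), w.partition.parts = m ↔ w.cycleType = c := by
    intro w
    constructor
    · intro h
      rw [← filter_parts_partition_eq_cycleType, h]
    · intro h
      rw [parts_partition, ← sum_cycleType, h, hm, Fintype.card_fin]
      congr 2
      omega
  have h1 := card_of_cycleType_mul_eq (Fin n) c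
  rw [if_pos ⟨by rw [Fintype.card_fin]; omega, fun a ha => (Multiset.mem_filter.1 ha).2⟩,
    Fintype.card_fin] at h1
  have hz : (n - c.sum).factorial * c.prod * ∏ i ∈ c.toFinset, (c.count i).factorial =
      centralizerOrder m := by
    unfold centralizerOrder
    have hsub : m.toFinset ⊆ insert 1 c.toFinset := by
      intro i hi
      rw [Multiset.mem_toFinset] at hi
      rw [Finset.mem_insert, Multiset.mem_toFinset, hc, Multiset.mem_filter]
      have := hpos i hi
      by_cases h : i = 1
      · exact Or.inl h
      · exact Or.inr ⟨hi, by omega⟩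
    have h1c : 1 ∉ c.toFinset := by simp [hc]
    rw [prod_count_factorial hsub, Finset.prod_insert h1c, show n - c.sum = m.count 1 by omega]
    have hp : m.prod = c.prod := by
      conv_lhs => rw [hm]
      simp
    rw [hp, Finset.prod_congr rfl (g := fun i => (m.count i).factorial) fun i hi => by
      rw [hc, Multiset.count_filter_of_pos (Multiset.mem_filter.1 (Multiset.mem_toFinset.1 hi)).2]]
    ring
  rw [hz] at h1
  simp only [hiff]
  exact h1

section
variable {R : Type*} [CommRing R] [Algebra ℚ R]

/-- The cycle index of the symmetric group `S_n`, evaluated at `x`. -/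
noncomputable def cycleIndex (x : ℕ → R) (n : ℕ) : R :=
  ∑ lam : n.Partition, ((centralizerOrder lam.parts : ℚ)⁻¹) • (lam.parts.map x).prod

theorem sum_perm_eq_cycleIndex (x : ℕ → R) (n : ℕ) :
    ((n.factorial : ℚ)⁻¹) • ∑ w : Perm (Fin n), (w.partition.parts.map x).prod =
      cycleIndex x n := by
  classical
  let f : Perm (Fin n) → n.Partition := fun w =>
    ⟨w.partition.parts, w.partition.parts_pos, by
      rw [w.partition.parts_sum, Fintype.card_fin]⟩
  have h : ∑ w : Perm (Fin n), (w.partition.parts.map x).prod =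
      ∑ w : Perm (Fin n), ((f w).parts.map x).prod := rfl
  rw [h, ← Finset.sum_fiberwise' Finset.univ f fun lam => (lam.parts.map x).prod,
    Finset.smul_sum, cycleIndex]
  refine Finset.sum_congr rfl fun lam _ => ?_
  rw [Finset.sum_const, ← Nat.cast_smul_eq_nsmul ℚ, smul_smul]
  congr 1
  have h1 := card_partition_eq_mul (fun i hi => lam.parts_pos hi) lam.parts_sum
  have h2 : (Finset.univ.filter fun w => f w = lam) =
      Finset.univ.filter fun w : Perm (Fin n) => w.partition.parts = lam.parts := by
    refine Finset.filter_congr fun w _ => ?_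
    rw [Nat.Partition.ext_iff]
  rw [h2]
  have h3 := centralizerOrder_ne_zero (fun i hi => lam.parts_pos hi)
  have h4 := n.factorial_ne_zero
  rw [← h1]
  rw [← h1] at h4
  push_cast
  have h5 := left_ne_zero_of_mul h4
  field_simp

theorem cycleIndex_zero (x : ℕ → R) : cycleIndex x 0 = 1 := by
  simp [cycleIndex, centralizerOrder]

/-- This is the derivative of `exp (∑ x_k t^k / k)`, read off coefficientwise. Weight each partition
by `n + 1 = ∑ k m_k`; deleting one part `k` divides the centralizer order by exactly `k m_k`. -/
theorem cycleIndex_succ (x : ℕ → R) (n : ℕ) :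
    ((n : ℚ) + 1) • cycleIndex x (n + 1) =
      ∑ k ∈ Finset.range (n + 1), x (k + 1) * cycleIndex x (n - k) := by
  classical
  have hw : ∀ lam : (n + 1).Partition, ((n : ℚ) + 1) =
      ∑ k ∈ Finset.range (n + 1), (((k + 1 : ℕ) : ℚ) * (lam.parts.count (k + 1) : ℚ)) := by
    intro lam
    have h1 := Finset.sum_multiset_count_of_subset lam.parts
      ((Finset.range (n + 1)).map ⟨Nat.succ, Nat.succ_injective⟩) (by
        intro i hi
        rw [Multiset.mem_toFinset] at hi
        have h1 := lam.parts_pos hi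
        have h2 := Nat.Partition.le_of_mem_parts hi
        simp only [Finset.mem_map, Finset.mem_range, Function.Embedding.coeFn_mk]
        exact ⟨i - 1, by omega, by omega⟩)
    rw [lam.parts_sum, Finset.sum_map] at h1
    have h2 := congrArg (Nat.cast : ℕ → ℚ) h1
    push_cast at h2
    rw [h2]
    refine Finset.sum_congr rfl fun k _ => ?_
    simp [mul_comm]
  unfold cycleIndex
  rw [Finset.smul_sum]
  simp_rw [fun lam : (n + 1).Partition => congrArg
    (· • ((centralizerOrder lam.parts : ℚ)⁻¹) • (lam.parts.map x).prod) (hw lam), Finset.sum_smul]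
  rw [Finset.sum_comm]
  refine Finset.sum_congr rfl fun k hk => ?_
  rw [Finset.mem_range] at hk
  have hsub : n - k = n + 1 - (k + 1) := by omega
  rw [hsub, Finset.mul_sum, ← Equiv.sum_comp (Nat.Partition.partitionWithPartEquiv
      (n := n + 1) (a := k + 1) (by omega) (by omega)),
    ← Finset.sum_filter_of_ne (p := fun lam : (n + 1).Partition => k + 1 ∈ lam.parts)]
  · rw [Finset.sum_subtype (p := fun lam : (n + 1).Partition => k + 1 ∈ lam.parts) _
      (fun lam => by simp)]
    refine Finset.sum_congr rfl fun lam _ => ?_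
    rw [Nat.Partition.partitionWithPartEquiv_apply_parts]
    have hcons := Multiset.cons_erase lam.2
    set μ := lam.1.parts.erase (k + 1) with hμ
    rw [← hcons, centralizerOrder_cons, Multiset.map_cons, Multiset.prod_cons, smul_smul,
      mul_smul_comm]
    congr 1
    have h1 : ((k + 1 : ℕ) : ℚ) ≠ 0 := by positivity
    have h2 : ((Multiset.count (k + 1) ((k + 1) ::ₘ μ) : ℕ) : ℚ) ≠ 0 := by
      rw [Multiset.count_cons_self]; positivity
    rw [Nat.cast_mul, Nat.cast_mul, mul_inv, ← mul_assoc, mul_inv_cancel₀ (mul_ne_zero h1 h2),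
      one_mul]
  · intro lam _ hne
    by_contra hcon
    rw [Multiset.count_eq_zero_of_notMem hcon] at hne
    simp at hne

end

end

/-! ### Newton identities, generating series and `ω` on power sums -/

section
open PowerSeries

theorem elemSym_zero : elemSym 0 = 1 := by
  classical
  ext d
  rw [MvPowerSeries.coeff_one]
  change (if _ ∧ _ then (1 : ℚ) else 0) = _
  refine if_congr ?_ rfl rfl
  rw [Finsupp.degree_eq_zero_iff]
  exact ⟨fun h => h.1, fun h => ⟨h, by simp [h]⟩⟩

theorem complSym_zero : complSym 0 = 1 := by
  classical
  ext d
  rw [MvPowerSeries.coeff_one]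
  change (if _ then (1 : ℚ) else 0) = _
  exact if_congr (Finsupp.degree_eq_zero_iff d) rfl rfl

/-- At `k = 0` the two sides differ in general: `powerSum 0` is 1, while the polynomial power sum is
`N`. -/
theorem killCompl_powerSum (N : ℕ) {k : ℕ} (hk : k ≠ 0) :
    MvPowerSeries.killCompl (R := ℚ) (Fin.valEmbedding (n := N)) (powerSum k) =
      ((MvPolynomial.psum (Fin N) ℚ k : MvPolynomial (Fin N) ℚ) : MvPowerSeries (Fin N) ℚ) := by
  classical
  ext d
  rw [MvPowerSeries.coeff_killCompl, MvPolynomial.coeff_coe, MvPolynomial.psum,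
    MvPolynomial.coeff_sum]
  simp only [MvPolynomial.coeff_X_pow]
  change (if _ then (1 : ℚ) else 0) = _
  have hiff : (∃ i, Finsupp.embDomain (Fin.valEmbedding (n := N)) d = Finsupp.single i k) ↔
      ∃ i : Fin N, Finsupp.single i k = d := by
    constructor
    · rintro ⟨i, hi⟩
      have h1 : i ∈ (Finsupp.embDomain (Fin.valEmbedding (n := N)) d).support := by
        simp [hi, hk]
      rw [Finsupp.support_embDomain, Finset.mem_map] at h1
      obtain ⟨j, -, rfl⟩ := h1
      refine ⟨j, ?_⟩
      rw [← Finsupp.embDomain_single] at hi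
      exact (Finsupp.embDomain_injective _ hi).symm
    · rintro ⟨i, rfl⟩
      exact ⟨_, Finsupp.embDomain_single _ _ _⟩
  rw [if_congr hiff rfl rfl]
  split_ifs with h
  · obtain ⟨i, rfl⟩ := h
    rw [Finset.sum_eq_single i]
    · simp
    · intro j _ hj
      rw [if_neg]
      intro h
      rcases Finsupp.single_eq_single_iff _ _ _ _ |>.1 h with h | h
      · exact hj h.1
      · exact hk h.1
    · simp
  · push Not at h
    rw [Finset.sum_eq_zero fun i _ => if_neg (h i)]

/-- A monomial involves finitely many variables, so identities of symmetric polynomials lift to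
infinitely many variables. -/
theorem ext_killCompl {f g : MvPowerSeries ℕ ℚ}
    (h : ∀ N, MvPowerSeries.killCompl (R := ℚ) (Fin.valEmbedding (n := N)) f =
      MvPowerSeries.killCompl (R := ℚ) (Fin.valEmbedding (n := N)) g) : f = g := by
  ext d
  obtain ⟨N, hN⟩ : ∃ N, ∀ i ∈ d.support, i < N :=
    ⟨d.support.sup id + 1, fun i hi => Nat.lt_succ_of_le (Finset.le_sup (f := id) hi)⟩
  obtain ⟨d', rfl⟩ : ∃ d', Finsupp.embDomain (Fin.valEmbedding (n := N)) d' = d := by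
    refine ⟨d.comapDomain _ Fin.val_injective.injOn, ?_⟩
    refine Finsupp.embDomain_comapDomain fun i hi => ?_
    exact ⟨⟨i, hN i hi⟩, rfl⟩
  have h1 := congrArg (MvPowerSeries.coeff d') (h _)
  rwa [MvPowerSeries.coeff_killCompl, MvPowerSeries.coeff_killCompl] at h1

theorem newton_elemSym (n : ℕ) :
    elemSym (n + 1) * ((n : MvPowerSeries ℕ ℚ) + 1) =
      ∑ a ∈ Finset.HasAntidiagonal.antidiagonal n, (-1) ^ a.1 * powerSum (a.1 + 1) * elemSym a.2 := by
  refine ext_killCompl fun N => ?_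
  simp only [map_mul, map_add, map_natCast, map_one, map_sum, map_pow, map_neg,
    killCompl_elemSym, killCompl_powerSum _ (Nat.succ_ne_zero _)]
  have h := MvPolynomial.mul_esymm_eq_sum (Fin N) ℚ (n + 1)
  rw [Finset.sum_filter, Finset.Nat.sum_antidiagonal_succ'] at h
  simp only [lt_irrefl, if_false, zero_add] at h
  rw [Finset.sum_congr rfl (g := fun a => (-1) ^ a.1 *
    MvPolynomial.esymm (Fin N) ℚ a.1 * MvPolynomial.psum (Fin N) ℚ (a.2 + 1)) fun a ha => by
      rw [Finset.HasAntidiagonal.mem_antidiagonal] at ha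
      rw [if_pos (by omega)], ← Finset.Nat.sum_antidiagonal_swap, Finset.mul_sum] at h
  have h2 := congrArg (MvPolynomial.coeToMvPowerSeries.ringHom (σ := Fin N) (R := ℚ)) h
  simp only [map_mul, map_sum, map_pow, map_neg, map_one, map_natCast,
    MvPolynomial.coeToMvPowerSeries.ringHom_apply, Prod.fst_swap, Prod.snd_swap] at h2
  rw [mul_comm, ← Nat.cast_one (R := MvPowerSeries (Fin N) ℚ), ← Nat.cast_add, h2]
  refine Finset.sum_congr rfl fun a ha => ?_
  rw [Finset.HasAntidiagonal.mem_antidiagonal] at ha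
  have hs : (-1 : MvPowerSeries (Fin N) ℚ) ^ (n + 1 + 1) * (-1) ^ a.2 = (-1) ^ a.1 := by
    rw [← ha, ← pow_add, show a.1 + a.2 + 1 + 1 + a.2 = a.1 + 2 * (a.2 + 1) by ring, pow_add,
      pow_mul]
    simp
  rw [Nat.cast_one, ← hs]
  ring

theorem coeff_powerSum_mul (k : ℕ) (F : MvPowerSeries ℕ ℚ) (d : ℕ →₀ ℕ) :
    MvPowerSeries.coeff d (powerSum (k + 1) * F) =
      ∑ i ∈ d.support, if k + 1 ≤ d i then
        MvPowerSeries.coeff (d - Finsupp.single i (k + 1)) F else 0 := by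
  classical
  rw [MvPowerSeries.coeff_mul]
  have h1 : ∀ u ∈ Finset.HasAntidiagonal.antidiagonal d, MvPowerSeries.coeff u.1 (powerSum (k + 1)) =
      ∑ i ∈ d.support, if u.1 = Finsupp.single i (k + 1) then (1 : ℚ) else 0 := by
    intro u hu
    rw [Finset.HasAntidiagonal.mem_antidiagonal] at hu
    change (if _ then (1 : ℚ) else 0) = _
    split_ifs with h
    · obtain ⟨i, hi⟩ := h
      have hid : i ∈ d.support := by
        rw [Finsupp.mem_support_iff, ← hu, Finsupp.add_apply, hi, Finsupp.single_eq_same]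
        omega
      rw [Finset.sum_eq_single i, if_pos hi]
      · intro j _ hj
        rw [if_neg]
        rw [hi]
        intro h
        rcases Finsupp.single_eq_single_iff _ _ _ _ |>.1 h with h | h
        · exact hj h.1.symm
        · omega
      · exact fun h => (h hid).elim
    · push Not at h
      rw [Finset.sum_eq_zero fun i _ => if_neg (h i)]
  rw [Finset.sum_congr rfl fun u hu => by rw [h1 u hu, Finset.sum_mul], Finset.sum_comm]
  refine Finset.sum_congr rfl fun i _ => ?_
  simp only [ite_mul, one_mul, zero_mul]
  have h2 : Finsupp.single i (k + 1) ≤ d ↔ k + 1 ≤ d i := Finsupp.single_le_iff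
  split_ifs with h
  · have h3 : Finsupp.single i (k + 1) + (d - Finsupp.single i (k + 1)) = d :=
      add_tsub_cancel_of_le (h2.2 h)
    rw [Finset.sum_eq_single (Finsupp.single i (k + 1), d - Finsupp.single i (k + 1)), if_pos rfl]
    · intro u hu hne
      rw [Finset.HasAntidiagonal.mem_antidiagonal] at hu
      refine if_neg fun hu1 => hne (Prod.ext hu1 ?_)
      rw [hu1] at hu
      exact add_left_cancel (hu.trans h3.symm)
    · exact fun hn => (hn (Finset.HasAntidiagonal.mem_antidiagonal.2 h3)).elim
  · refine Finset.sum_eq_zero fun u hu => if_neg fun hu1 => h (h2.1 ?_)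
    rw [Finset.HasAntidiagonal.mem_antidiagonal] at hu
    rw [← hu1, ← hu]
    exact le_self_add

/-- At a monomial `d` of degree `n + 1` the right side counts pairs `(i, k)` with `k + 1 ≤ d i`, of
which there are `∑ d i = n + 1`. -/
theorem newton_complSym (n : ℕ) :
    complSym (n + 1) * ((n : MvPowerSeries ℕ ℚ) + 1) =
      ∑ a ∈ Finset.HasAntidiagonal.antidiagonal n, powerSum (a.1 + 1) * complSym a.2 := by
  classical
  ext d
  rw [show (n : MvPowerSeries ℕ ℚ) + 1 = ((n + 1 : ℕ) : MvPowerSeries ℕ ℚ) by push_cast; rfl,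
    mul_comm, ← nsmul_eq_mul, map_nsmul, map_sum]
  simp only [coeff_powerSum_mul]
  rw [Finset.sum_comm]
  change (n + 1) • (if _ then (1 : ℚ) else 0) = _
  have h1 : ∀ i k, k + 1 ≤ d i →
      (d - Finsupp.single i (k + 1)).degree + (k + 1) = d.degree := by
    intro i k h
    have h2 : d - Finsupp.single i (k + 1) + Finsupp.single i (k + 1) = d :=
      tsub_add_cancel_of_le (Finsupp.single_le_iff.2 h)
    conv_rhs => rw [← h2]
    rw [map_add, Finsupp.degree_single]
  have h2 : ∀ i, ∀ a ∈ Finset.HasAntidiagonal.antidiagonal n, (if a.1 + 1 ≤ d i then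
      MvPowerSeries.coeff (d - Finsupp.single i (a.1 + 1)) (complSym a.2) else 0) =
      if a.1 + 1 ≤ d i ∧ d.degree = n + 1 then (1 : ℚ) else 0 := by
    intro i a ha
    rw [Finset.HasAntidiagonal.mem_antidiagonal] at ha
    rw [ite_and]
    split_ifs with h h'
    · change (if _ then (1 : ℚ) else 0) = _
      rw [if_pos]
      have := h1 i a.1 h
      omega
    · change (if _ then (1 : ℚ) else 0) = _
      rw [if_neg]
      have := h1 i a.1 h
      omega
    · rfl
  rw [Finset.sum_congr rfl fun i _ => Finset.sum_congr rfl (h2 i)]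
  by_cases hd : d.degree = n + 1
  · simp only [hd, and_true, if_true]
    rw [Finset.sum_congr rfl (g := fun i => (d i : ℚ))]
    · rw [← Nat.cast_sum, ← Finsupp.degree_apply, hd]
      simp
    · intro i hi
      rw [Finset.Nat.sum_antidiagonal_eq_sum_range_succ_mk, Finset.sum_boole]
      have hle : d i ≤ n + 1 := hd ▸ Finsupp.le_degree i d
      have : (Finset.range n.succ).filter (fun k => k + 1 ≤ d i) = Finset.range (d i) := by
        ext k
        simp only [Finset.mem_filter, Finset.mem_range]
        omega
      simp only [this, Finset.card_range]
  · simp [hd]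

theorem elemSym_mem (n : ℕ) : elemSym n ∈ symFun := by
  rcases n with _ | n
  · rw [elemSym_zero]; exact one_mem _
  · exact Algebra.subset_adjoin ⟨n, rfl⟩

theorem powerSum_mem (n : ℕ) : powerSum (n + 1) ∈ symFun := by
  induction n using Nat.strong_induction_on with
  | _ n ih =>
    have h := newton_elemSym n
    rw [Finset.Nat.sum_antidiagonal_eq_sum_range_succ_mk, Finset.sum_range_succ] at h
    simp only [Nat.sub_self, elemSym_zero, mul_one] at h
    have hu : ((-1 : MvPowerSeries ℕ ℚ) ^ n) * (-1) ^ n = 1 := by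
      rw [← mul_pow]; simp
    have h2 : powerSum (n + 1) = (-1) ^ n * (elemSym (n + 1) * ((n : MvPowerSeries ℕ ℚ) + 1) -
        ∑ k ∈ Finset.range n, (-1) ^ k * powerSum (k + 1) * elemSym (n - k)) := by
      rw [h, add_sub_cancel_left, ← mul_assoc, hu, one_mul]
    rw [h2]
    have hneg : ∀ k : ℕ, (-1 : MvPowerSeries ℕ ℚ) ^ k ∈ symFun := fun k =>
      pow_mem (neg_mem (one_mem _)) k
    refine mul_mem (hneg n) (sub_mem (mul_mem (elemSym_mem _)
      (add_mem (natCast_mem _ n) (one_mem _))) (sum_mem fun k hk => ?_))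
    exact mul_mem (mul_mem (hneg k) (ih k (Finset.mem_range.1 hk))) (elemSym_mem _)

theorem complSym_mem (n : ℕ) : complSym n ∈ symFun := by
  induction n using Nat.strong_induction_on with
  | _ n ih =>
    rcases n with _ | n
    · rw [complSym_zero]; exact one_mem _
    · have h := newton_complSym n
      have h2 : complSym (n + 1) = ((n : ℚ) + 1)⁻¹ •
          ∑ a ∈ Finset.HasAntidiagonal.antidiagonal n, powerSum (a.1 + 1) * complSym a.2 := by
        rw [← h, eq_inv_smul_iff₀ (by positivity), add_smul, one_smul, mul_add, mul_one,
          Nat.cast_smul_eq_nsmul, nsmul_eq_mul, mul_comm]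
      rw [h2]
      refine Subalgebra.smul_mem _ (sum_mem fun a ha => mul_mem (powerSum_mem _) (ih _ ?_)) _
      rw [Finset.HasAntidiagonal.mem_antidiagonal] at ha
      omega

/-- The generating series of the elementary symmetric functions. -/
noncomputable def elemSeries : (MvPowerSeries ℕ ℚ)⟦X⟧ := mk elemSym

/-- The generating series of the complete homogeneous symmetric functions. -/
noncomputable def complSeries : (MvPowerSeries ℕ ℚ)⟦X⟧ := mk complSym

theorem derivative_elemSeries : d⁄dX _ elemSeries =
    (mk fun k => (-1) ^ k * powerSum (k + 1)) * elemSeries := by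
  ext1 n
  rw [coeff_derivative, coeff_mul]
  simp only [elemSeries, coeff_mk]
  exact newton_elemSym n

theorem derivative_complSeries : d⁄dX _ complSeries =
    (mk fun k => powerSum (k + 1)) * complSeries := by
  ext1 n
  rw [coeff_derivative, coeff_mul]
  simp only [complSeries, coeff_mk]
  exact newton_complSym n

theorem complSeries_ne_zero : complSeries ≠ 0 := by
  intro h
  have := congrArg (coeff 0) h
  simp [complSeries, complSym_zero] at this

theorem omega_elemSym_mem (n : ℕ) : omega ⟨elemSym n, elemSym_mem n⟩ = complSym n := by
  rcases n with _ | n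
  · have : (⟨elemSym 0, elemSym_mem 0⟩ : symFun) = 1 := Subtype.ext elemSym_zero
    rw [this, map_one, complSym_zero]
  · exact omega_elemSym n

/-- Applying `ω` to Newton's identities for the `e_k` gives a second formula for the derivative of
`H`; cancelling `H` against Newton's identities for the `h_k` identifies the images. -/
theorem omega_powerSum (n : ℕ) :
    omega ⟨powerSum (n + 1), powerSum_mem n⟩ = (-1) ^ n * powerSum (n + 1) := by
  have h : (mk fun k => (-1) ^ k * omega ⟨powerSum (k + 1), powerSum_mem k⟩) * complSeries =
      (mk fun k => powerSum (k + 1)) * complSeries := by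
    rw [← derivative_complSeries]
    ext1 n
    rw [coeff_derivative, coeff_mul]
    simp only [complSeries, coeff_mk]
    have h1 : (⟨elemSym (n + 1), elemSym_mem (n + 1)⟩ : symFun) * ((n : symFun) + 1) =
      ∑ a ∈ Finset.HasAntidiagonal.antidiagonal n, (-1) ^ a.1 * ⟨powerSum (a.1 + 1), powerSum_mem _⟩ *
        ⟨elemSym a.2, elemSym_mem _⟩ := by
      apply Subtype.ext
      push_cast
      exact newton_elemSym n
    have h2 := congrArg omega h1
    simpa only [map_mul, map_add, map_natCast, map_one, map_sum, map_pow, map_neg,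
      omega_elemSym_mem] using h2.symm
  have h2 := congrArg (coeff n) (mul_right_cancel₀ complSeries_ne_zero h)
  simp only [coeff_mk] at h2
  have h3 := congrArg ((-1) ^ n * ·) h2
  simp only [← mul_assoc, ← mul_pow] at h3
  simpa using h3

end

/-! ### Superfication and shiftification -/

section

theorem ext_coeffX {F G : MvPowerSeries (ℕ ⊕ ℕ) ℚ} (h : ∀ a, coeffX a F = coeffX a G) :
    F = G := by
  ext d
  have h1 := congrArg (MvPowerSeries.coeff (Finsupp.sumFinsuppEquivProdFinsupp d).2)
    (h (Finsupp.sumFinsuppEquivProdFinsupp d).1)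
  have h2 : Finsupp.sumElim (Finsupp.sumFinsuppEquivProdFinsupp d).1
      (Finsupp.sumFinsuppEquivProdFinsupp d).2 = d :=
    Finsupp.sumFinsuppEquivProdFinsupp.symm_apply_apply d
  change MvPowerSeries.coeff (Finsupp.sumElim _ _) F =
    MvPowerSeries.coeff (Finsupp.sumElim _ _) G at h1
  rwa [h2] at h1

theorem coeffX_add (a : ℕ →₀ ℕ) (F G : MvPowerSeries (ℕ ⊕ ℕ) ℚ) :
    coeffX a (F + G) = coeffX a F + coeffX a G := rfl

theorem coeffX_smul (a : ℕ →₀ ℕ) (c : ℚ) (F : MvPowerSeries (ℕ ⊕ ℕ) ℚ) :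
    coeffX a (c • F) = c • coeffX a F := rfl

theorem coeffX_mul (a : ℕ →₀ ℕ) (F G : MvPowerSeries (ℕ ⊕ ℕ) ℚ) :
    coeffX a (F * G) =
      ∑ u ∈ Finset.HasAntidiagonal.antidiagonal a, coeffX u.1 F * coeffX u.2 G := by
  classical
  ext b
  rw [map_sum]
  change MvPowerSeries.coeff (Finsupp.sumElim a b) (F * G) = _
  simp only [MvPowerSeries.coeff_mul]
  rw [← Finset.sum_product']
  let e := Finsupp.sumFinsuppAddEquivProdFinsupp (M := ℕ) (α := ℕ) (β := ℕ)
  have he : ∀ d, Finsupp.sumElim (e d).1 (e d).2 = d := fun d => e.symm_apply_apply d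
  have he' : ∀ u v, e (Finsupp.sumElim u v) = (u, v) := fun u v => e.apply_symm_apply (u, v)
  refine Finset.sum_bij' (fun d _ => (((e d.1).1, (e d.2).1), ((e d.1).2, (e d.2).2)))
    (fun u _ => (Finsupp.sumElim u.1.1 u.2.1, Finsupp.sumElim u.1.2 u.2.2)) ?_ ?_ ?_ ?_ ?_
  · intro d hd
    rw [Finset.HasAntidiagonal.mem_antidiagonal] at hd
    have h := congrArg e hd
    rw [map_add, he'] at h
    simp only [Finset.mem_product, Finset.HasAntidiagonal.mem_antidiagonal]
    exact ⟨congrArg Prod.fst h, congrArg Prod.snd h⟩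
  · intro u hu
    simp only [Finset.mem_product, Finset.HasAntidiagonal.mem_antidiagonal] at hu ⊢
    rw [← Finsupp.sumElim_add, hu.1, hu.2]
  · intro d _
    simp only [he]
  · intro u _
    simp only [he']
  · intro d _
    change _ = MvPowerSeries.coeff (Finsupp.sumElim _ _) F *
      MvPowerSeries.coeff (Finsupp.sumElim _ _) G
    rw [he, he]

theorem coeffX_rename_inl (a : ℕ →₀ ℕ) (f : MvPowerSeries ℕ ℚ) :
    coeffX a (MvPowerSeries.rename (Function.Embedding.inl : ℕ ↪ ℕ ⊕ ℕ) f) =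
      MvPowerSeries.coeff a f • 1 := by
  classical
  ext b
  change MvPowerSeries.coeff (Finsupp.sumElim a b) (MvPowerSeries.rename
    (Function.Embedding.inl : ℕ ↪ ℕ ⊕ ℕ) f) = _
  rw [MvPowerSeries.coeff_smul, MvPowerSeries.coeff_one]
  by_cases hb : b = 0
  · rw [hb, ← Finsupp.embDomain_inl, MvPowerSeries.coeff_embDomain_rename]
    simp
  · rw [MvPowerSeries.coeff_rename_eq_zero, if_neg hb, mul_zero]
    rintro ⟨u, hu⟩
    rw [← Finsupp.embDomain_eq_mapDomain, Finsupp.embDomain_inl] at hu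
    refine hb (Finsupp.ext fun i => ?_)
    exact (DFunLike.congr_fun hu (Sum.inr i)).symm

theorem coeffX_rename_inr (a : ℕ →₀ ℕ) (f : MvPowerSeries ℕ ℚ) :
    coeffX a (MvPowerSeries.rename (Function.Embedding.inr : ℕ ↪ ℕ ⊕ ℕ) f) =
      (if a = 0 then (1 : ℚ) else 0) • f := by
  classical
  ext b
  change MvPowerSeries.coeff (Finsupp.sumElim a b) (MvPowerSeries.rename
    (Function.Embedding.inr : ℕ ↪ ℕ ⊕ ℕ) f) = _
  rw [MvPowerSeries.coeff_smul]
  by_cases ha : a = 0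
  · rw [ha, ← Finsupp.embDomain_inr, MvPowerSeries.coeff_embDomain_rename]
    simp
  · rw [MvPowerSeries.coeff_rename_eq_zero, if_neg ha, zero_mul]
    rintro ⟨u, hu⟩
    rw [← Finsupp.embDomain_eq_mapDomain, Finsupp.embDomain_inr] at hu
    refine ha (Finsupp.ext fun i => ?_)
    exact (DFunLike.congr_fun hu (Sum.inl i)).symm

/-- `G` is obtained from `F` by applying `ω` to the coefficient of each monomial in `x`. -/
def IsOmegaY (F G : MvPowerSeries (ℕ ⊕ ℕ) ℚ) : Prop :=
  ∀ a, ∃ h : coeffX a F ∈ symFun, coeffX a G = omega ⟨coeffX a F, h⟩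

/-- The default value 0 in `omegaY` obstructs direct algebra. The relation `IsOmegaY` carries
membership along, is stable under sums, scalars and products, and determines `omegaY`. -/
theorem IsOmegaY.omegaY_eq {F G : MvPowerSeries (ℕ ⊕ ℕ) ℚ} (h : IsOmegaY F G) :
    omegaY F = G := by
  refine ext_coeffX fun a => ?_
  obtain ⟨h1, h2⟩ := h a
  rw [h2]
  ext b
  change omegaY F (Finsupp.sumElim a b) = _
  have he : Finsupp.sumFinsuppEquivProdFinsupp (Finsupp.sumElim a b) = (a, b) :=
    Finsupp.sumFinsuppEquivProdFinsupp.apply_symm_apply (a, b)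
  have ha := congrArg Prod.fst he
  have hb := congrArg Prod.snd he
  simp only at ha hb
  unfold omegaY
  simp only [hb]
  rw [dif_pos (by rw [ha]; exact h1)]
  simp only [ha]

theorem IsOmegaY.add {F G F' G' : MvPowerSeries (ℕ ⊕ ℕ) ℚ} (h : IsOmegaY F G)
    (h' : IsOmegaY F' G') : IsOmegaY (F + F') (G + G') := by
  intro a
  obtain ⟨h1, h2⟩ := h a
  obtain ⟨h1', h2'⟩ := h' a
  refine ⟨add_mem h1 h1', ?_⟩
  rw [coeffX_add, h2, h2', ← map_add]
  rfl

theorem IsOmegaY.smul {F G : MvPowerSeries (ℕ ⊕ ℕ) ℚ} (h : IsOmegaY F G) (c : ℚ) :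
    IsOmegaY (c • F) (c • G) := by
  intro a
  obtain ⟨h1, h2⟩ := h a
  refine ⟨Subalgebra.smul_mem _ h1 c, ?_⟩
  rw [coeffX_smul, h2, ← map_smul]
  rfl

theorem IsOmegaY.mul {F G F' G' : MvPowerSeries (ℕ ⊕ ℕ) ℚ} (h : IsOmegaY F G)
    (h' : IsOmegaY F' G') : IsOmegaY (F * F') (G * G') := by
  choose h1 h2 using h
  choose h1' h2' using h'
  intro a
  have hm : coeffX a (F * F') = ((∑ u ∈ Finset.HasAntidiagonal.antidiagonal a,
      (⟨coeffX u.1 F, h1 u.1⟩ : symFun) * ⟨coeffX u.2 F', h1' u.2⟩ : symFun) :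
        MvPowerSeries ℕ ℚ) := by
    rw [coeffX_mul]
    push_cast
    rfl
  refine ⟨hm ▸ Subtype.prop _, ?_⟩
  rw [coeffX_mul]
  simp only [hm, h2, h2', Subtype.coe_eta, map_sum, map_mul]

/-- `f` is a symmetric function whose shiftification is `g`. -/
def IsShift (f g : MvPowerSeries ℕ ℚ) : Prop :=
  ∃ G, IsOmegaY (twoAlphabets f) G ∧
    MvPowerSeries.rename (Sum.elim id id : ℕ ⊕ ℕ → ℕ) G = g

theorem IsShift.shiftification_eq {f g : MvPowerSeries ℕ ℚ} (h : IsShift f g) :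
    shiftification f = g := by
  obtain ⟨G, h1, h2⟩ := h
  rw [shiftification, superfication, h1.omegaY_eq, h2]

theorem IsShift.add {f g f' g' : MvPowerSeries ℕ ℚ} (h : IsShift f g) (h' : IsShift f' g') :
    IsShift (f + f') (g + g') := by
  obtain ⟨G, h1, rfl⟩ := h
  obtain ⟨G', h1', rfl⟩ := h'
  refine ⟨G + G', ?_, map_add _ _ _⟩
  rw [twoAlphabets, map_add]
  exact h1.add h1'

theorem IsShift.smul {f g : MvPowerSeries ℕ ℚ} (h : IsShift f g) (c : ℚ) :
    IsShift (c • f) (c • g) := by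
  obtain ⟨G, h1, rfl⟩ := h
  refine ⟨c • G, ?_, map_smul _ _ _⟩
  rw [twoAlphabets, map_smul]
  exact h1.smul c

theorem IsShift.mul {f g f' g' : MvPowerSeries ℕ ℚ} (h : IsShift f g) (h' : IsShift f' g') :
    IsShift (f * f') (g * g') := by
  obtain ⟨G, h1, rfl⟩ := h
  obtain ⟨G', h1', rfl⟩ := h'
  refine ⟨G * G', ?_, map_mul _ _ _⟩
  rw [twoAlphabets, map_mul]
  exact h1.mul h1'

theorem isShift_one : IsShift 1 1 := by
  classical
  refine ⟨1, ?_, map_one _⟩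
  rw [twoAlphabets, map_one]
  have h1 : ∀ a, coeffX a 1 = (if a = 0 then (1 : ℚ) else 0) • 1 := by
    intro a
    have := coeffX_rename_inr a 1
    rwa [map_one] at this
  intro a
  have h2 : coeffX a 1 =
      (((if a = 0 then (1 : ℚ) else 0) • (1 : symFun) : symFun) : MvPowerSeries ℕ ℚ) := by
    rw [h1]; rfl
  refine ⟨h2 ▸ Subtype.prop _, ?_⟩
  simp only [h2, Subtype.coe_eta, map_smul, map_one]
  rfl

theorem IsShift.sum {ι : Type*} (s : Finset ι) {f g : ι → MvPowerSeries ℕ ℚ}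
    (h : ∀ i ∈ s, IsShift (f i) (g i)) : IsShift (∑ i ∈ s, f i) (∑ i ∈ s, g i) := by
  classical
  induction s using Finset.induction_on with
  | empty => simpa using isShift_one.smul 0
  | insert i s hi ih =>
    rw [Finset.sum_insert hi, Finset.sum_insert hi]
    exact (h i (Finset.mem_insert_self _ _)).add
      (ih fun j hj => h j (Finset.mem_insert_of_mem hj))

theorem IsShift.multiset_prod (m : Multiset ℕ) {f g : ℕ → MvPowerSeries ℕ ℚ}
    (h : ∀ i ∈ m, IsShift (f i) (g i)) : IsShift (m.map f).prod (m.map g).prod := by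
  induction m using Multiset.induction_on with
  | empty => simpa using isShift_one
  | cons i m ih =>
    simp only [Multiset.map_cons, Multiset.prod_cons]
    exact (h i (Multiset.mem_cons_self _ _)).mul
      (ih fun j hj => h j (Multiset.mem_cons_of_mem hj))

theorem twoAlphabets_powerSum (k : ℕ) :
    twoAlphabets (powerSum (k + 1)) =
      MvPowerSeries.rename (Function.Embedding.inl : ℕ ↪ ℕ ⊕ ℕ) (powerSum (k + 1)) +
      MvPowerSeries.rename (Function.Embedding.inr : ℕ ↪ ℕ ⊕ ℕ) (powerSum (k + 1)) := by
  classical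
  refine ext_coeffX fun a => ?_
  rw [coeffX_add, coeffX_rename_inl, coeffX_rename_inr]
  ext b
  rw [map_add, MvPowerSeries.coeff_smul, MvPowerSeries.coeff_smul, MvPowerSeries.coeff_one]
  have hL : MvPowerSeries.coeff b (coeffX a (twoAlphabets (powerSum (k + 1)))) =
      if ∃ j, Finsupp.sumElim a b = Finsupp.single j (k + 1) then 1 else 0 := by
    change MvPowerSeries.coeff (Finsupp.sumElim a b) (twoAlphabets (powerSum (k + 1))) = _
    set d := Finsupp.sumElim a b
    let e := Equiv.natSumNatEquivNat
    have hd : Finsupp.embDomain e.symm.toEmbedding (Finsupp.embDomain e.toEmbedding d) = d := by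
      rw [Finsupp.embDomain_eq_mapDomain, Finsupp.embDomain_eq_mapDomain, ← Finsupp.mapDomain_comp]
      have : (e.symm.toEmbedding : ℕ → ℕ ⊕ ℕ) ∘ (e.toEmbedding : ℕ ⊕ ℕ → ℕ) = id := by
        ext1 x; simp
      rw [this, Finsupp.mapDomain_id]
    have h1 := MvPowerSeries.coeff_embDomain_rename e.symm.toEmbedding (powerSum (k + 1))
      (Finsupp.embDomain e.toEmbedding d)
    rw [hd] at h1
    refine h1.trans ?_
    change (if _ then (1 : ℚ) else 0) = _
    refine if_congr ⟨?_, ?_⟩ rfl rfl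
    · rintro ⟨i, hi⟩
      refine ⟨e.symm i, ?_⟩
      rw [← hd, hi, Finsupp.embDomain_single]
      rfl
    · rintro ⟨j, hj⟩
      exact ⟨e j, by rw [hj, Finsupp.embDomain_single]; rfl⟩
  rw [hL]
  change _ = (if ∃ i, a = Finsupp.single i (k + 1) then (1 : ℚ) else 0) * _ +
    _ * (if ∃ i, b = Finsupp.single i (k + 1) then (1 : ℚ) else 0)
  have hinl : ∀ i, Finsupp.sumElim a b = Finsupp.single (Sum.inl i) (k + 1) ↔
      a = Finsupp.single i (k + 1) ∧ b = 0 := by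
    intro i
    rw [← Finsupp.sumElim_single_zero]
    exact Finsupp.sumFinsuppEquivProdFinsupp.symm.injective.eq_iff (a := (a, b))
      (b := (Finsupp.single i (k + 1), 0)) |>.trans Prod.mk_inj
  have hinr : ∀ i, Finsupp.sumElim a b = Finsupp.single (Sum.inr i) (k + 1) ↔
      a = 0 ∧ b = Finsupp.single i (k + 1) := by
    intro i
    rw [← Finsupp.sumElim_zero_single]
    exact Finsupp.sumFinsuppEquivProdFinsupp.symm.injective.eq_iff (a := (a, b))
      (b := (0, Finsupp.single i (k + 1))) |>.trans Prod.mk_inj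
  simp only [Sum.exists, hinl, hinr, exists_and_left, exists_and_right]
  have hne : ∀ i : ℕ, (0 : ℕ →₀ ℕ) ≠ Finsupp.single i (k + 1) := fun i h => by
    have := DFunLike.congr_fun h i
    simp at this
  by_cases ha : a = 0
  · simp only [ha, hne, exists_false, false_and, false_or, true_and, if_true, if_false, zero_mul,
      zero_add, one_mul]
  · by_cases hb : b = 0
    · simp [ha, hb]
    · simp [ha, hb]

/-- Power sums are additive over alphabets, so `p_(k+1)(x/y) = p_(k+1)(x) + (-1)^k p_(k+1)(y)`. -/
theorem isShift_powerSum (k : ℕ) :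
    IsShift (powerSum (k + 1)) ((1 + (-1) ^ k : ℚ) • powerSum (k + 1)) := by
  classical
  refine ⟨MvPowerSeries.rename (Function.Embedding.inl : ℕ ↪ ℕ ⊕ ℕ) (powerSum (k + 1)) +
    ((-1) ^ k : ℚ) •
      MvPowerSeries.rename (Function.Embedding.inr : ℕ ↪ ℕ ⊕ ℕ) (powerSum (k + 1)), ?_, ?_⟩
  · rw [twoAlphabets_powerSum]
    refine IsOmegaY.add (fun a => ?_) (fun a => ?_)
    · have h : coeffX a (MvPowerSeries.rename (Function.Embedding.inl : ℕ ↪ ℕ ⊕ ℕ)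
          (powerSum (k + 1))) = ((MvPowerSeries.coeff a (powerSum (k + 1)) • (1 : symFun) :
            symFun) : MvPowerSeries ℕ ℚ) := by
        rw [coeffX_rename_inl]; rfl
      refine ⟨h ▸ Subtype.prop _, ?_⟩
      simp only [h, Subtype.coe_eta, map_smul, map_one]
      rfl
    · have h : coeffX a (MvPowerSeries.rename (Function.Embedding.inr : ℕ ↪ ℕ ⊕ ℕ)
          (powerSum (k + 1))) = (((if a = 0 then (1 : ℚ) else 0) •
            (⟨powerSum (k + 1), powerSum_mem k⟩ : symFun) : symFun) : MvPowerSeries ℕ ℚ) := by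
        rw [coeffX_rename_inr]; rfl
      refine ⟨h ▸ Subtype.prop _, ?_⟩
      have hs : ((-1) ^ k : ℚ) • powerSum (k + 1) = (-1) ^ k * powerSum (k + 1) := by
        rw [Algebra.smul_def, map_pow, map_neg, map_one]
      simp only [coeffX_smul, h, Subtype.coe_eta, map_smul, omega_powerSum]
      rw [SetLike.val_smul, smul_comm, hs]
  · rw [map_add, map_smul, MvPowerSeries.rename_rename, MvPowerSeries.rename_rename, add_smul,
      one_smul]
    have h1 : (Sum.elim id id : ℕ ⊕ ℕ → ℕ) ∘ (Function.Embedding.inl : ℕ ↪ ℕ ⊕ ℕ) = id := rfl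
    have h2 : (Sum.elim id id : ℕ ⊕ ℕ → ℕ) ∘ (Function.Embedding.inr : ℕ ↪ ℕ ⊕ ℕ) = id := rfl
    simp only [h1, h2, MvPowerSeries.rename_id_apply]

end

/-! ### Power series: odd multinomials and the expansion of `(u + √(1 + u²))^α` -/

section
open PowerSeries

section
variable {R : Type*} [CommRing R]

theorem coeff_zero_subst {A : R⟦X⟧} (hA : coeff 0 A = 0) (G : R⟦X⟧) :
    coeff 0 (G.subst A) = coeff 0 G := by
  rw [coeff_zero_eq_constantCoeff] at hA
  rw [coeff_subst' (HasSubst.of_constantCoeff_zero' hA), finsum_eq_single _ 0]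
  · simp
  · intro l hl
    simp [hA, hl]

theorem coeff_pow_of_lt {A : R⟦X⟧} (hA : coeff 0 A = 0) {n l : ℕ} (h : n < l) :
    coeff n (A ^ l) = 0 := by
  rw [coeff_zero_eq_constantCoeff] at hA
  exact X_pow_dvd_iff.1 (pow_dvd_pow_of_dvd (X_dvd_iff.2 hA) l) n h

theorem coeff_subst_eq_sum {A : R⟦X⟧} (hA : coeff 0 A = 0) (G : R⟦X⟧) (n : ℕ) :
    coeff n (G.subst A) = ∑ l ∈ Finset.range (n + 1), coeff l G * coeff n (A ^ l) := by
  rw [coeff_subst' (HasSubst.of_constantCoeff_zero' (by simpa using hA)),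
    finsum_eq_sum_of_support_subset]
  · rfl
  · intro l hl
    by_contra hcon
    rw [Finset.coe_range, Set.mem_Iio] at hcon
    exact hl (show coeff l G • coeff n (A ^ l) = 0 by
      rw [coeff_pow_of_lt hA (by omega), smul_zero])

theorem prod_map_C_mul_X_pow (a : ℕ → R) (m : Multiset ℕ) :
    (m.map fun k => C (a k) * (X : R⟦X⟧) ^ k).prod = C (m.map a).prod * X ^ m.sum := by
  induction m using Multiset.induction_on with
  | empty => simp
  | cons k m ih =>
    simp only [Multiset.map_cons, Multiset.prod_cons, ih, Multiset.sum_cons, map_mul, pow_add]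
    ring

/-- The multinomial theorem for a power series that is odd. -/
theorem coeff_pow_eq_sum_odds {A : R⟦X⟧} (hA : ∀ k, Even k → coeff k A = 0) (n l : ℕ) :
    coeff n (A ^ l) = ∑ lam ∈ (Nat.Partition.odds n).filter (fun lam => lam.parts.card = l),
      (lam.parts.countPerms : R) * (lam.parts.map fun k => coeff k A).prod := by
  classical
  set s := (Finset.range (n + 1)).filter fun k => ¬ Even k with hs
  -- Only coefficients up to `n` matter, so truncation makes `A` a finite sum to which the
  -- multinomial theorem applies.
  have hT : ((trunc (n + 1) A : Polynomial R) : R⟦X⟧) =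
      ∑ k ∈ s, C (coeff k A) * (X : R⟦X⟧) ^ k := by
    ext1 m
    rw [Polynomial.coeff_coe, coeff_trunc, map_sum]
    simp only [coeff_C_mul_X_pow]
    rw [Finset.sum_ite_eq]
    by_cases hm : m < n + 1
    · by_cases he : Even m
      · simp [hs, hm, he, hA]
      · simp [hs, hm, he]
    · simp [hs, hm]
  have h1 : coeff n (A ^ l) = coeff n (((trunc (n + 1) A : Polynomial R) : R⟦X⟧) ^ l) := by
    rw [← coeff_coe_trunc_of_lt (Nat.lt_succ_self n), ← trunc_trunc_pow,
      coeff_coe_trunc_of_lt (Nat.lt_succ_self n)]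
  rw [h1, hT, Finset.sum_pow, map_sum]
  simp only [prod_map_C_mul_X_pow]
  have h2 : ∀ m : Multiset ℕ, coeff n ((m.countPerms : R⟦X⟧) *
      (C (m.map fun k => coeff k A).prod * X ^ m.sum)) =
      if m.sum = n then (m.countPerms : R) * (m.map fun k => coeff k A).prod else 0 := by
    intro m
    rw [← map_natCast (C (R := R)), coeff_C_mul, coeff_C_mul_X_pow, mul_ite, mul_zero]
    exact if_congr eq_comm rfl rfl
  simp only [h2]
  rw [← Finset.sum_filter]
  symm
  refine Finset.sum_bij (fun lam h => (⟨lam.parts, (Finset.mem_filter.1 h).2⟩ : Sym ℕ l))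
    ?_ ?_ ?_ ?_
  · intro lam h
    obtain ⟨h3, h4⟩ := Finset.mem_filter.1 h
    refine Finset.mem_filter.2 ⟨Finset.mem_sym_iff.2 fun k hk => ?_, lam.parts_sum⟩
    have hk' : k ∈ lam.parts := hk
    rw [hs, Finset.mem_filter, Finset.mem_range]
    exact ⟨Nat.lt_succ_of_le (Nat.Partition.le_of_mem_parts hk'),
      (Finset.mem_filter.1 h3).2 k hk'⟩
  · intro lam _ mu _ h
    exact Nat.Partition.ext (congrArg Subtype.val h)
  · rintro ⟨m, hm⟩ h
    obtain ⟨h3, h4⟩ := Finset.mem_filter.1 h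
    have hk : ∀ k ∈ m, ¬ Even k := fun k hk =>
      (Finset.mem_filter.1 (Finset.mem_sym_iff.1 h3 k hk)).2
    refine ⟨⟨m, fun {k} hkm => Nat.pos_of_ne_zero fun h0 => hk k hkm (h0 ▸ Even.zero), h4⟩,
      ?_, rfl⟩
    exact Finset.mem_filter.2 ⟨Finset.mem_filter.2 ⟨Finset.mem_univ _, hk⟩, hm⟩
  · intro lam _
    rfl

end

section
variable {R : Type*} [CommRing R] [NoZeroDivisors R] [CharZero R]

/-- Uniqueness for a first-order linear equation: `n + 1` times the next coefficient is a
combination of earlier ones, and `n + 1` is not a zero divisor. -/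
theorem eq_zero_of_derivative_eq_mul {W f : R⟦X⟧} (h : d⁄dX R W = f * W)
    (h0 : coeff 0 W = 0) : W = 0 := by
  ext1 n
  rw [map_zero]
  induction n using Nat.strong_induction_on with
  | _ n ih =>
    rcases n with _ | n
    · exact h0
    · have h1 := congrArg (coeff n) h
      rw [coeff_derivative, coeff_mul, Finset.sum_eq_zero] at h1
      · exact (mul_eq_zero.1 h1).resolve_right (by exact_mod_cast n.succ_ne_zero)
      · intro a ha
        rw [Finset.HasAntidiagonal.mem_antidiagonal] at ha
        rw [ih a.2 (by omega), mul_zero]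

theorem eq_of_derivative_eq_mul {F G f : R⟦X⟧} (hF : d⁄dX R F = f * F) (hG : d⁄dX R G = f * G)
    (h0 : coeff 0 F = coeff 0 G) : F = G := by
  refine sub_eq_zero.1 (eq_zero_of_derivative_eq_mul (f := f) ?_ ?_)
  · rw [map_sub, hF, hG, mul_sub]
  · rw [map_sub, h0, sub_self]

end

/-- The coefficients `ℓ! [u^ℓ] (u + √(1 + u²))^α`. -/
def arcsinhCoeff (α : ℚ) (l : ℕ) : ℚ :=
  if l = 0 then 1 else α * ∏ j ∈ Finset.range (l - 1), (α + l - 2 - 2 * j)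

/-- For `l > 0`, passing from `l` to `l + 2` adds only the outermost factors `α + l` and `α - l` of
the product. This is the recurrence of `(1 + u²) F'' + u F' = α² F`. -/
theorem arcsinhCoeff_add_two (α : ℚ) (l : ℕ) :
    arcsinhCoeff α (l + 2) = (α ^ 2 - l ^ 2) * arcsinhCoeff α l := by
  rcases l with _ | l
  · simp [arcsinhCoeff]
    ring
  · simp only [arcsinhCoeff, Nat.succ_ne_zero, if_false, Nat.add_sub_cancel,
      show l + 1 + 2 - 1 = l + 1 + 1 by omega]
    rw [Finset.prod_range_succ, Finset.prod_range_succ']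
    have : ∀ j ∈ Finset.range l, (α + ((l + 1 + 2 : ℕ) : ℚ) - 2 - 2 * ((j + 1 : ℕ) : ℚ)) =
        α + ((l + 1 : ℕ) : ℚ) - 2 - 2 * (j : ℚ) := by
      intro j _
      push_cast
      ring
    rw [Finset.prod_congr rfl this]
    push_cast
    ring

section
variable {R : Type*} [CommRing R] [Algebra ℚ R]

/-- The expansion of `(u + √(1 + u²))^α` in powers of `u`. -/
noncomputable def arcsinhSeries (R : Type*) [CommRing R] [Algebra ℚ R] (α : ℚ) : R⟦X⟧ :=
  mk fun l => algebraMap ℚ R (arcsinhCoeff α l / l.factorial)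

theorem arcsinhSeries_ode (α : ℚ) :
    d⁄dX R (d⁄dX R (arcsinhSeries R α)) + X * (d⁄dX R (arcsinhSeries R α) +
      X * d⁄dX R (d⁄dX R (arcsinhSeries R α))) =
        C (algebraMap ℚ R α ^ 2) * arcsinhSeries R α := by
  have h : d⁄dX R (arcsinhSeries R α) + X * d⁄dX R (d⁄dX R (arcsinhSeries R α)) =
      d⁄dX R (X * d⁄dX R (arcsinhSeries R α)) := by
    rw [Derivation.leibniz, derivative_X]
    simp only [smul_eq_mul]
    ring
  rw [h]
  have hrec : ∀ l : ℕ, arcsinhCoeff α (l + 2) / ((l + 2).factorial : ℚ) * (l + 1 + 1) * (l + 1) +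
      (l : ℚ) ^ 2 * (arcsinhCoeff α l / l.factorial) =
      α ^ 2 * (arcsinhCoeff α l / l.factorial) := by
    intro l
    rw [arcsinhCoeff_add_two, Nat.factorial_succ, Nat.factorial_succ]
    have := l.factorial_ne_zero
    push_cast
    field_simp
    ring
  ext1 l
  rw [map_add, coeff_C_mul]
  rcases l with _ | l
  · have := congrArg (algebraMap ℚ R) (hrec 0)
    rw [coeff_derivative, coeff_derivative, coeff_zero_X_mul]
    simp only [arcsinhSeries, coeff_mk]
    simpa using this
  · have := congrArg (algebraMap ℚ R) (hrec (l + 1))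
    rw [coeff_derivative, coeff_derivative, coeff_succ_X_mul, coeff_derivative, coeff_succ_X_mul,
      coeff_derivative]
    simp only [arcsinhSeries, coeff_mk]
    simp only [map_add, map_mul, map_pow, map_natCast, map_one, Nat.cast_add, Nat.cast_one]
      at this ⊢
    rw [← this]
    ring

/-- Think of `A = sinh Ψ`, `B = cosh Ψ` with `Ψ' = ψ`; then `F(A)` should be `exp (α Ψ)`. -/
theorem derivative_arcsinhSeries_subst [NoZeroDivisors R] [CharZero R] {ψ A B : R⟦X⟧} (α : ℚ)
    (hA : d⁄dX R A = ψ * B) (hB : d⁄dX R B = ψ * A) (hA0 : coeff 0 A = 0) (hB0 : coeff 0 B = 1) :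
    d⁄dX R ((arcsinhSeries R α).subst A) =
      C (algebraMap ℚ R α) * ψ * (arcsinhSeries R α).subst A := by
  have hs : HasSubst A := HasSubst.of_constantCoeff_zero' (by simpa using hA0)
  have hAB : B ^ 2 = 1 + A ^ 2 := by
    have : B ^ 2 - A ^ 2 - 1 = 0 := by
      refine eq_zero_of_derivative_eq_mul (f := 0) ?_ ?_
      · rw [map_sub, map_sub, derivative_pow, derivative_pow, derivative_one, hA, hB]
        push_cast
        ring
      · simp only [coeff_zero_eq_constantCoeff] at hA0 hB0 ⊢
        simp [hA0, hB0]
    linear_combination this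
  set F := arcsinhSeries R α with hF
  set F₁ := d⁄dX R F with hF₁
  set F₂ := d⁄dX R F₁ with hF₂
  have hode : F₂.subst A + A * (F₁.subst A + A * F₂.subst A) =
      C (algebraMap ℚ R α ^ 2) * F.subst A := by
    have h1 := congrArg (subst A) (arcsinhSeries_ode (R := R) α)
    rw [← hF, ← hF₁, ← hF₂] at h1
    rw [subst_add hs, subst_mul hs, subst_add hs, subst_mul hs, subst_mul hs, subst_X hs,
      subst_C] at h1
    exact h1
  -- The second-order equation factors: `W = B F'(A) - α F(A)` satisfies `W' = -α ψ W`, and its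
  -- constant term is `α - α = 0`.
  have hW : B * F₁.subst A - C (algebraMap ℚ R α) * F.subst A = 0 := by
    refine eq_zero_of_derivative_eq_mul (f := - (C (algebraMap ℚ R α) * ψ)) ?_ ?_
    · rw [map_sub, Derivation.leibniz, Derivation.leibniz, derivative_subst hs,
        derivative_subst hs, ← hF₁, ← hF₂, hA, hB, derivative_C]
      simp only [smul_eq_mul, mul_zero, add_zero]
      rw [map_pow] at hode
      linear_combination ψ * hode + ψ * F₂.subst A * hAB
    · rw [map_sub, coeff_C_mul, coeff_mul, Finset.Nat.antidiagonal_zero, Finset.sum_singleton,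
        coeff_zero_subst hA0, coeff_zero_subst hA0, hB0, hF₁, coeff_derivative, hF]
      simp [arcsinhSeries, arcsinhCoeff]
  rw [derivative_subst hs, ← hF₁, hA]
  linear_combination ψ * hW

end

end

/-! ### The expansion of `sh_n` and positivity -/

section
open PowerSeries

instance : CharZero (MvPowerSeries ℕ ℚ) := algebraRat.charZero _

/-- The generating series of `∑ k, e_k h_{n-k}`. -/
noncomputable def schurSeries : (MvPowerSeries ℕ ℚ)⟦X⟧ := elemSeries * complSeries

theorem coeff_schurSeries (n : ℕ) : coeff n schurSeries = (2 : ℚ) • schurP n := by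
  rw [schurSeries, coeff_mul, Finset.Nat.sum_antidiagonal_eq_sum_range_succ_mk, schurP, smul_smul]
  norm_num [elemSeries, complSeries]

theorem coeff_zero_schurSeries : coeff 0 schurSeries = 1 := by
  simp [schurSeries, elemSeries, complSeries, elemSym_zero, complSym_zero]

/-- The logarithmic derivative of `schurSeries`. -/
noncomputable def oddPowerSeries : (MvPowerSeries ℕ ℚ)⟦X⟧ :=
  mk fun k => (1 - (-1) ^ (k + 1) : ℚ) • powerSum (k + 1)

theorem derivative_schurSeries : d⁄dX _ schurSeries = oddPowerSeries * schurSeries := by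
  have h : oddPowerSeries = (mk fun k => (-1) ^ k * powerSum (k + 1)) +
      mk fun k => powerSum (k + 1) := by
    ext1 k
    simp only [oddPowerSeries, map_add, coeff_mk]
    rw [sub_smul, one_smul, Algebra.smul_def, map_pow, map_neg, map_one, pow_succ]
    ring
  rw [schurSeries, Derivation.leibniz, derivative_elemSeries, derivative_complSeries, h]
  simp only [smul_eq_mul]
  ring

theorem derivative_rescale_neg_one {R : Type*} [CommRing R] (F : R⟦X⟧) :
    d⁄dX R (rescale (-1) F) = - rescale (-1) (d⁄dX R F) := by
  ext1 n
  rw [map_neg, coeff_derivative, coeff_rescale, coeff_rescale, coeff_derivative]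
  ring

/-- Evenness of the logarithmic derivative is what couples `schurOdd` and `schurEven` into a
`sinh`/`cosh` system. -/
theorem rescale_oddPowerSeries : rescale (-1) oddPowerSeries = oddPowerSeries := by
  ext1 k
  rw [coeff_rescale, oddPowerSeries, coeff_mk]
  rcases Nat.even_or_odd k with h | h
  · rw [h.neg_one_pow, one_mul]
  · rw [h.add_one.neg_one_pow]
    simp

open scoped Classical in
/-- The part of `schurSeries` of odd degree. -/
noncomputable def schurOdd : (MvPowerSeries ℕ ℚ)⟦X⟧ :=
  mk fun n => if Even n then 0 else coeff n schurSeries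

open scoped Classical in
/-- The part of `schurSeries` of even degree. -/
noncomputable def schurEven : (MvPowerSeries ℕ ℚ)⟦X⟧ :=
  mk fun n => if Even n then coeff n schurSeries else 0

theorem two_mul_schurOdd : 2 * schurOdd = schurSeries - rescale (-1) schurSeries := by
  ext1 n
  rw [two_mul, map_add, map_sub, coeff_rescale, schurOdd, coeff_mk]
  rcases Nat.even_or_odd n with h | h
  · simp [h, h.neg_one_pow]
  · simp [Nat.not_even_iff_odd.2 h, h.neg_one_pow]

theorem two_mul_schurEven : 2 * schurEven = schurSeries + rescale (-1) schurSeries := by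
  ext1 n
  rw [two_mul, map_add, map_add, coeff_rescale, schurEven, coeff_mk]
  rcases Nat.even_or_odd n with h | h
  · simp [h, h.neg_one_pow]
  · simp [Nat.not_even_iff_odd.2 h, h.neg_one_pow]

theorem derivative_two_mul {R : Type*} [CommRing R] (F : R⟦X⟧) :
    d⁄dX R (2 * F) = 2 * d⁄dX R F := by
  rw [two_mul, two_mul, map_add]

theorem powerSeries_two_ne_zero : (2 : (MvPowerSeries ℕ ℚ)⟦X⟧) ≠ 0 := by
  intro h
  have h1 := congrArg constantCoeff h
  rw [map_ofNat, map_zero] at h1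
  exact two_ne_zero h1

theorem derivative_schurOdd : d⁄dX _ schurOdd = oddPowerSeries * schurEven := by
  refine mul_left_cancel₀ powerSeries_two_ne_zero ?_
  rw [← derivative_two_mul, two_mul_schurOdd, map_sub, derivative_rescale_neg_one,
    derivative_schurSeries, map_mul, rescale_oddPowerSeries]
  linear_combination -oddPowerSeries * two_mul_schurEven

theorem derivative_schurEven : d⁄dX _ schurEven = oddPowerSeries * schurOdd := by
  refine mul_left_cancel₀ powerSeries_two_ne_zero ?_
  rw [← derivative_two_mul, two_mul_schurEven, map_add, derivative_rescale_neg_one,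
    derivative_schurSeries, map_mul, rescale_oddPowerSeries]
  linear_combination -oddPowerSeries * two_mul_schurOdd

/-- Both generating series play the role of `Q^α`: constant term 1 and logarithmic derivative `α`
times that of `Q`. -/
theorem cycleIndex_eq_coeff (α : ℚ) (n : ℕ) :
    cycleIndex (fun k => α • (1 - (-1) ^ k : ℚ) • powerSum k) n =
      coeff n ((arcsinhSeries (MvPowerSeries ℕ ℚ) α).subst schurOdd) := by
  set y : ℕ → MvPowerSeries ℕ ℚ := fun k => α • (1 - (-1) ^ k : ℚ) • powerSum k with hy
  have h0 : coeff 0 schurOdd = 0 := by simp [schurOdd]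
  have h1 : coeff 0 schurEven = 1 := by
    simp only [schurEven, coeff_mk, Even.zero, if_true]
    exact coeff_zero_schurSeries
  have h : mk (cycleIndex y) = (arcsinhSeries (MvPowerSeries ℕ ℚ) α).subst schurOdd := by
    refine eq_of_derivative_eq_mul ?_ (derivative_arcsinhSeries_subst α derivative_schurOdd
      derivative_schurEven h0 h1) ?_
    · ext1 n
      have h2 := cycleIndex_succ y n
      rw [coeff_derivative, coeff_mk, coeff_mul,
        Finset.Nat.sum_antidiagonal_eq_sum_range_succ_mk]
      simp only [coeff_C_mul, oddPowerSeries, coeff_mk]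
      rw [Algebra.smul_def, map_add, map_natCast, map_one, mul_comm] at h2
      rw [h2]
      refine Finset.sum_congr rfl fun k _ => ?_
      rw [hy]
      simp only
      rw [Algebra.smul_def α]
    · rw [coeff_mk, cycleIndex_zero, coeff_zero_subst h0]
      simp [arcsinhSeries, arcsinhCoeff]
  rw [← h, coeff_mk]

theorem multiset_prod_map_smul (c : ℚ) (f : ℕ → MvPowerSeries ℕ ℚ) (m : Multiset ℕ) :
    (m.map fun k => c • f k).prod = c ^ m.card • (m.map f).prod := by
  induction m using Multiset.induction_on with
  | empty => simp
  | cons k m ih =>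
    simp only [Multiset.map_cons, Multiset.prod_cons, ih, Multiset.card_cons, smul_mul_smul_comm,
      pow_succ']

theorem isShift_parkingSym (n : ℕ) :
    IsShift (parkingSym n) (((n : ℚ) + 1)⁻¹ •
      cycleIndex (fun k => ((n : ℚ) + 1) • (1 - (-1) ^ k : ℚ) • powerSum k) n) := by
  rw [← sum_perm_eq_cycleIndex, smul_comm, Finset.smul_sum]
  refine IsShift.smul (IsShift.sum _ fun w _ => ?_) _
  have hfix : (Nat.card (MulAction.fixedBy (Parking n) w) : ℚ) =
      ((n : ℚ) + 1)⁻¹ * ((n : ℚ) + 1) ^ w.partition.parts.card := by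
    rw [eq_inv_mul_iff_mul_eq₀ (by positivity), mul_comm]
    exact_mod_cast card_fixedBy_parking n w
  rw [multiset_prod_map_smul, smul_smul, ← hfix]
  refine IsShift.smul (IsShift.multiset_prod _ fun k hk => ?_) _
  obtain ⟨j, rfl⟩ := Nat.exists_eq_succ_of_ne_zero (w.partition.parts_pos hk).ne'
  have := isShift_powerSum j
  rwa [show (1 + (-1) ^ j : ℚ) = 1 - (-1) ^ (j + 1) by rw [pow_succ]; ring] at this

theorem shiftedCoeff_eq {n : ℕ} (lam : n.Partition) :
    shiftedCoeff lam = ((n : ℚ) + 1)⁻¹ * (arcsinhCoeff (n + 1) lam.parts.card /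
      lam.parts.card.factorial * (lam.parts.countPerms * 2 ^ lam.parts.card)) := by
  have hm : lam.parts.countPerms =
      Nat.multinomial lam.parts.toFinset fun i => lam.parts.count i := by
    rw [Multiset.countPerms, Finsupp.multinomial_eq, Multiset.toFinsupp_support]
    rfl
  rw [shiftedCoeff, hm, arcsinhCoeff]
  have hn : (n : ℚ) + 1 ≠ 0 := by positivity
  split_ifs with h
  -- The empty partition occurs only for `n = 0`, where the prefactor `(n + 1)⁻¹` is 1; otherwise it
  -- cancels the leading `α = n + 1`.
  · have hn0 : n = 0 := by
      rw [Multiset.card_eq_zero] at h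
      rw [← lam.parts_sum, h, Multiset.sum_zero]
    subst hn0
    rw [h]
    simp
  · have hp : ∀ j ∈ Finset.range (lam.parts.card - 1),
        (n : ℚ) + lam.parts.card - 1 - 2 * j = n + 1 + lam.parts.card - 2 - 2 * j :=
      fun j _ => by ring
    rw [Finset.prod_congr rfl hp]
    field_simp

theorem shiftedParkingSym_eq (n : ℕ) :
    shiftedParkingSym n = ∑ lam ∈ Nat.Partition.odds n, shiftedCoeff lam • prodP lam := by
  classical
  rw [shiftedParkingSym, (isShift_parkingSym n).shiftification_eq, cycleIndex_eq_coeff,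
    coeff_subst_eq_sum (by simp [schurOdd]), Finset.smul_sum,
    ← Finset.sum_fiberwise_of_maps_to (s := Nat.Partition.odds n) (t := Finset.range (n + 1))
      (g := fun lam => lam.parts.card)]
  · refine Finset.sum_congr rfl fun l _ => ?_
    rw [coeff_pow_eq_sum_odds (fun k hk => by simp [schurOdd, hk]), Finset.mul_sum,
      Finset.smul_sum]
    refine Finset.sum_congr rfl fun lam hlam => ?_
    obtain ⟨h1, rfl⟩ := Finset.mem_filter.1 hlam
    have h2 : (lam.parts.map fun k => coeff k schurOdd).prod =
        (2 : ℚ) ^ lam.parts.card • prodP lam := by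
      rw [Multiset.map_congr rfl (g := fun k => (2 : ℚ) • schurP k)]
      · rw [multiset_prod_map_smul, prodP]
      · intro k hk
        have := (Finset.mem_filter.1 h1).2 k hk
        rw [schurOdd, coeff_mk, if_neg this, coeff_schurSeries]
    rw [h2, shiftedCoeff_eq, arcsinhSeries, coeff_mk, ← Algebra.smul_def,
      ← map_natCast (algebraMap ℚ (MvPowerSeries ℕ ℚ)), ← Algebra.smul_def, smul_smul, smul_smul,
      smul_smul]
    congr 1
    ring
  · intro lam _
    have : lam.parts.card ≤ lam.parts.sum := by
      simpa using Multiset.card_nsmul_le_sum (s := lam.parts) (a := 1)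
        fun i hi => lam.parts_pos hi
    rw [lam.parts_sum] at this
    exact Finset.mem_range.2 (Nat.lt_succ_of_le this)

theorem shiftedCoeff_nonneg {n : ℕ} (lam : n.Partition) : 0 ≤ shiftedCoeff lam := by
  have hcard : lam.parts.card ≤ n := by
    conv_rhs => rw [← lam.parts_sum]
    simpa using Multiset.card_nsmul_le_sum (s := lam.parts) (a := 1)
      fun i hi => lam.parts_pos hi
  rw [shiftedCoeff]
  refine mul_nonneg (by positivity) (Finset.prod_nonneg fun j hj => ?_)
  rw [Finset.mem_range] at hj
  -- A factor exists only if `ℓ ≥ 2`, and then `j ≤ ℓ - 2` and `ℓ ≤ n` bound it below by `n - ℓ + 3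
  -- > 0`.
  have h1 : j + 2 ≤ lam.parts.card := by omega
  have h2 : ((j + 2 : ℕ) : ℚ) ≤ lam.parts.card := by exact_mod_cast h1
  have h3 : (lam.parts.card : ℚ) ≤ n := by exact_mod_cast hcard
  push_cast at h2
  linarith

end

/-! ### Algebraic independence of the odd `P_k` -/

section
open PowerSeries

theorem elemSeries_mul_rescale_complSeries : elemSeries * rescale (-1) complSeries = 1 := by
  have h : rescale (-1) (mk fun k => powerSum (k + 1)) =
      mk fun k => (-1 : MvPowerSeries ℕ ℚ) ^ k * powerSum (k + 1) := rescale_mk _ _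
  refine eq_of_derivative_eq_mul (f := 0) ?_ ?_ ?_
  · rw [Derivation.leibniz, derivative_rescale_neg_one, derivative_complSeries,
      derivative_elemSeries, map_mul, h]
    simp only [smul_eq_mul]
    ring
  · rw [derivative_one, zero_mul]
  · simp [elemSeries, complSeries, rescale_mk, elemSym_zero, complSym_zero]

/-- The quadratic equation `a = x (1 - a²)` is solvable in power series, with `a` odd if `x` is. -/
theorem exists_odd_quadratic_solution {S : Type*} [CommRing S] [NoZeroDivisors S] [Nontrivial S]
    {x : S⟦X⟧} (hx : rescale (-1) x = -x) (hx0 : coeff 0 x = 0) :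
    ∃ a : S⟦X⟧, a = x * (1 - a ^ 2) ∧ rescale (-1) a = -a := by
  rw [coeff_zero_eq_constantCoeff] at hx0
  have hs : HasSubst (-x ^ 2) := HasSubst.of_constantCoeff_zero' (by simp [hx0])
  let c : S⟦X⟧ := map (Nat.castRingHom S) catalanSeries
  have hc : c ^ 2 * X + 1 = c := by
    have := congrArg (map (Nat.castRingHom S)) catalanSeries_sq_mul_X_add_one
    simpa only [map_add, map_mul, map_pow, map_one, map_X] using this
  -- The Catalan equation `c = 1 + X c²` at `X = -x²` makes `a = x c'` satisfy `a = x (1 - a²)`.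
  let c' : S⟦X⟧ := c.subst (-x ^ 2)
  have hc' : c' ^ 2 * (-x ^ 2) + 1 = c' := by
    have := congrArg (substAlgHom (R := S) hs) hc
    rw [map_add, map_mul, map_pow, map_one, substAlgHom_X, coe_substAlgHom] at this
    exact this
  have ha : x * c' = x * (1 - (x * c') ^ 2) := by
    linear_combination -x * hc'
  refine ⟨x * c', ha, ?_⟩
  have hb := congrArg (rescale (-1)) ha
  generalize x * c' = a at ha hb ⊢
  rw [map_mul, map_sub, map_one, map_pow, hx] at hb
  set b := rescale (-1) a with hb'
  -- Oddness of `a` follows from the equation alone: the second factor has constant term 1, so `a +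
  -- b` must vanish.
  have h1 : (a + b) * (1 + x * (a - b)) = 0 := by
    linear_combination ha + hb
  rcases mul_eq_zero.1 h1 with h | h
  · linear_combination h
  · have := congrArg constantCoeff h
    simp [hx0] at this

theorem schurP_mem (n : ℕ) : schurP n ∈ symFun :=
  Subalgebra.smul_mem _ (sum_mem fun _ _ => mul_mem (elemSym_mem _) (complSym_mem _)) _

theorem exists_algHom_schurP : ∃ θ : symFun →ₐ[ℚ] MvPolynomial ℕ ℚ,
    ∀ i, θ ⟨schurP (2 * i + 1), schurP_mem _⟩ = MvPolynomial.X i := by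
  classical
  let x : (MvPolynomial ℕ ℚ)⟦X⟧ := mk fun n => if Even n then 0 else MvPolynomial.X (n / 2)
  have hx : rescale (-1) x = -x := by
    ext1 n
    rw [coeff_rescale, map_neg]
    simp only [x, coeff_mk]
    rcases Nat.even_or_odd n with h | h
    · simp [h]
    · simp [h.neg_one_pow, Nat.not_even_iff_odd.2 h]
  obtain ⟨a, ha, ha'⟩ := exists_odd_quadratic_solution hx (by simp [x])
  have ha0 : coeff 0 a = 0 := by
    rw [ha, coeff_zero_eq_constantCoeff]
    simp [x]
  let θ : symFun →ₐ[ℚ] MvPolynomial ℕ ℚ :=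
    (MvPolynomial.aeval fun i : ℕ => coeff (i + 1) (1 + a)).comp
      elemSym_algebraicIndependent.aevalEquiv.symm.toAlgHom
  have hθ : ∀ n, θ ⟨elemSym n, elemSym_mem n⟩ = coeff n (1 + a) := by
    intro n
    rcases n with _ | n
    · have : (⟨elemSym 0, elemSym_mem 0⟩ : symFun) = 1 := Subtype.ext elemSym_zero
      rw [this, map_one, map_add, ha0]
      simp
    · have h : (⟨elemSym (n + 1), elemSym_mem (n + 1)⟩ : symFun) =
          elemSym_algebraicIndependent.aevalEquiv (MvPolynomial.X n) := by
        apply Subtype.ext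
        simp
      change MvPolynomial.aeval _ (elemSym_algebraicIndependent.aevalEquiv.symm _) = _
      rw [h, AlgEquiv.symm_apply_apply, MvPolynomial.aeval_X]
  let E : symFun⟦X⟧ := mk fun n => ⟨elemSym n, elemSym_mem n⟩
  let H : symFun⟦X⟧ := mk fun n => ⟨complSym n, complSym_mem n⟩
  have hEH : E * rescale (-1) H = 1 := by
    apply PowerSeries.map_injective (symFun.val : symFun →+* MvPowerSeries ℕ ℚ)
      Subtype.val_injective
    rw [map_mul, map_one, ← rescale_map, map_neg, map_one]
    exact elemSeries_mul_rescale_complSeries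
  let T : symFun⟦X⟧ →+* (MvPolynomial ℕ ℚ)⟦X⟧ := map (θ : symFun →+* MvPolynomial ℕ ℚ)
  have hE : T E = 1 + a := by
    ext1 n
    simp only [T, E, coeff_map, coeff_mk]
    exact hθ n
  have hTEH : (1 + a) * rescale (-1) (T H) = 1 := by
    have := congrArg T hEH
    rw [map_mul, map_one, hE] at this
    have h2 := rescale_map (θ : symFun →+* MvPolynomial ℕ ℚ) (-1) H
    rw [map_neg, map_one] at h2
    rwa [show rescale (-1) (T H) = T (rescale (-1) H) from h2]
  have hTEH' : (1 - a) * T H = 1 := by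
    have := congrArg (rescale (-1)) hTEH
    rwa [map_mul, map_one, map_add, map_one, ha', rescale_rescale, neg_one_mul, neg_neg,
      rescale_one, RingHom.id_apply, ← sub_eq_add_neg] at this
  -- With `H = 1/(1 - a)` this reads `(1 + a)/(1 - a) - (1 - a)/(1 + a) = 4a/(1 - a²)`. The 4
  -- matches odd coefficients: 2 from the antisymmetrization and 2 from `q_k = 2 P_k`.
  have hQ : T (E * H) - rescale (-1) (T (E * H)) = 4 * x := by
    rw [map_mul, hE, map_mul, map_add, map_one, ha']
    linear_combination (-(1 + a) * T H + 4 * x * (1 - a) * T H) * hTEH +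
      ((1 - a) * rescale (-1) (T H) + 4 * x) * hTEH' + 4 * T H * rescale (-1) (T H) * ha
  refine ⟨θ, fun i => ?_⟩
  have h1 := congrArg (coeff (2 * i + 1)) hQ
  have hodd : Odd (2 * i + 1) := odd_two_mul_add_one i
  have h4 : (4 : (MvPolynomial ℕ ℚ)⟦X⟧) = C 4 := (map_ofNat C 4).symm
  rw [map_sub, coeff_rescale, hodd.neg_one_pow, h4, coeff_C_mul] at h1
  have hx1 : coeff (2 * i + 1) x = MvPolynomial.X i := by
    simp only [x, coeff_mk, Nat.not_even_iff_odd.2 hodd, if_false]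
    congr 1
    omega
  have hT : coeff (2 * i + 1) (T (E * H)) =
      2 * θ ⟨schurP (2 * i + 1), schurP_mem _⟩ := by
    have h5 : coeff (2 * i + 1) (E * H) =
        ⟨schurP (2 * i + 1), schurP_mem _⟩ + ⟨schurP (2 * i + 1), schurP_mem _⟩ := by
      apply Subtype.ext
      have h6 := coeff_schurSeries (2 * i + 1)
      rw [schurSeries, coeff_mul] at h6
      rw [coeff_mul]
      simp only [E, H, coeff_mk, elemSeries, complSeries] at h6 ⊢
      push_cast
      rw [h6, two_smul]
    rw [two_mul (θ _), ← map_add, ← h5]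
    exact coeff_map _ _ _
  rw [hT, hx1] at h1
  have h7 : (4 : MvPolynomial ℕ ℚ) ≠ 0 := by norm_num
  apply mul_left_cancel₀ h7
  linear_combination h1

theorem schurP_odd_algebraicIndependent :
    AlgebraicIndependent ℚ fun i : ℕ => schurP (2 * i + 1) := by
  obtain ⟨θ, hθ⟩ := exists_algHom_schurP
  have h : AlgebraicIndependent ℚ
      fun i : ℕ => (⟨schurP (2 * i + 1), schurP_mem _⟩ : symFun) := by
    refine AlgebraicIndependent.of_comp θ ?_
    rw [show (θ ∘ fun i : ℕ => (⟨schurP (2 * i + 1), schurP_mem _⟩ : symFun)) =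
      MvPolynomial.X from funext hθ]
    exact MvPolynomial.algebraicIndependent_X ℕ ℚ
  exact h.map' (f := symFun.val) Subtype.val_injective

end

end ShiftedParking

theorem theorem3 :
    AlgebraicIndependent ℚ (fun i : ℕ => ShiftedParking.schurP (2 * i + 1)) ∧
    ∀ n : ℕ,
      ShiftedParking.shiftedParkingSym n =
        ∑ lam ∈ Nat.Partition.odds n,
          ShiftedParking.shiftedCoeff lam • ShiftedParking.prodP lam ∧
      ∀ lam ∈ Nat.Partition.odds n, 0 ≤ ShiftedParking.shiftedCoeff lam := by
  exact ⟨ShiftedParking.schurP_odd_algebraicIndependent, fun n =>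
    ⟨ShiftedParking.shiftedParkingSym_eq n, fun lam _ => ShiftedParking.shiftedCoeff_nonneg lam⟩⟩
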